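/- All graphs are finite, undirected and simple. A graph is $3$-connected if it has at least four vertices and remains connected after the deletion of any set of at most two vertices. Let $m\ge 1$ be an integer, let $T_0$ be any tree with $m$ vertices, and let $G$ be a $3$-connected graph in which every vertex has degree at least $m+3$. Then $G$ contains a (not necessarily induced) subgraph $T$ isomorphic to $T_0$ such that the graph $G-V(T)$, obtained from $G$ by deleting all vertices of $T$, is $3$-connected. -/

import Mathlib

/-- A finite simple graph is `k`-connected if it has more than `k` vertices and it stays connected
after the deletion of any set of fewer than `k` vertices. -/
def SimpleGraph.IsKConnected {V : Type*} [Finite V] (G : SimpleGraph V) (k : ℕ) : Prop :=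
  k < Nat.card V ∧ ∀ S : Finset V, S.card < k → (G.induce ((S : Set V)ᶜ)).Connected

/-- A finite tree with a chosen root, recorded by its parent map. -/
structure ParentTree (W : Type*) where
  root : W
  parent : W → W
  depth : W → ℕ
  depth_parent_lt : ∀ w, w ≠ root → depth (parent w) < depth w

namespace ParentTree

section

open scoped Classical

variable {W V : Type*} (T : ParentTree W) (G : SimpleGraph V)

/-- `φ` embeds the rooted tree `T` into the subgraph of `G` induced on `Z`. -/
structure IsEmb (Z : Finset V) (φ : W → V) : Prop where
  inj : Function.Injective φ
  adj : ∀ w, w ≠ T.root → G.Adj (φ w) (φ (T.parent w))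
  mem : ∀ w, φ w ∈ Z

/-- `G` contains a copy of `T` with all vertices in `Z`. -/
def HasCopy (Z : Finset V) : Prop := ∃ φ, T.IsEmb G Z φ

/-- `T.Desc y w` says that `w` is a descendant of `y` (possibly `y` itself). -/
def Desc (y w : W) : Prop := Relation.ReflTransGen (fun a b => b ≠ T.root ∧ T.parent b = a) y w

variable {T G}

lemma Desc.refl (y : W) : T.Desc y y := Relation.ReflTransGen.refl

lemma Desc.trans {a b c : W} (h : T.Desc a b) (h' : T.Desc b c) : T.Desc a c :=
  Relation.ReflTransGen.trans h h'

lemma desc_of_parent {t n : W} (h : t ≠ T.root) (h' : T.parent t = n) : T.Desc n t :=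
  Relation.ReflTransGen.single ⟨h, h'⟩

lemma Desc.parent {y w : W} (h : T.Desc y w) (hne : w ≠ y) :
    w ≠ T.root ∧ T.Desc y (T.parent w) := by
  rcases Relation.ReflTransGen.cases_tail h with h | ⟨c, hc, h1, h2⟩
  · exact absurd h hne
  · exact ⟨h1, by rw [h2]; exact hc⟩

lemma Desc.depth_le {y w : W} (h : T.Desc y w) : T.depth y ≤ T.depth w := by
  induction h with
  | refl => exact le_rfl
  | tail _ h ih =>
    obtain ⟨h1, h2⟩ := h
    have := T.depth_parent_lt _ h1
    rw [h2] at this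
    omega

lemma Desc.depth_lt {y w : W} (h : T.Desc y w) (hne : w ≠ y) : T.depth y < T.depth w := by
  obtain ⟨h1, h2⟩ := h.parent hne
  have := T.depth_parent_lt _ h1
  have := h2.depth_le
  omega

lemma desc_root (w : W) : T.Desc T.root w := by
  induction h : T.depth w using Nat.strong_induction_on generalizing w with
  | _ n ih =>
    by_cases hw : w = T.root
    · rw [hw]; exact Desc.refl _
    · exact (ih _ (h ▸ T.depth_parent_lt w hw) _ rfl).trans (desc_of_parent hw rfl)

lemma Desc.total {a b l : W} (ha : T.Desc a l) (hb : T.Desc b l) : T.Desc a b ∨ T.Desc b a := by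
  induction ha with
  | refl => exact Or.inr hb
  | @tail c d _ h ih =>
    by_cases hbd : d = b
    · subst hbd
      exact Or.inl (Relation.ReflTransGen.tail ‹_› h)
    · have := (hb.parent hbd).2
      rw [h.2] at this
      exact ih this

lemma exists_leaf_desc [Fintype W] (c : W) : ∃ l, T.Desc c l ∧ ∀ w, w ≠ T.root → T.parent w ≠ l := by
  obtain ⟨l, hl, hmax⟩ := Finset.exists_max_image (Finset.univ.filter (T.Desc c)) T.depth
    ⟨c, by simp [Desc.refl]⟩
  simp only [Finset.mem_filter, Finset.mem_univ, true_and] at hl hmax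
  refine ⟨l, hl, fun w hw h => ?_⟩
  have h1 := hmax w (hl.trans (desc_of_parent hw h))
  have h2 := T.depth_parent_lt w hw
  rw [h] at h2
  omega

/-- Greedy embedding: the vertices of `S` are placed one after the other, by increasing depth, in
their domains `D`, while the images of `K` stay fixed. -/
lemma greedy_extension (D : W → Finset V) (φ : W → V) (K : Finset W)
    (hinj : Set.InjOn φ K) (n : ℕ) : ∀ (S : Finset W), S.card = n → Disjoint K S →
    T.root ∉ S → (∀ w ∈ S, T.parent w ∈ K ∪ S) →
    (∀ w ∈ S, T.parent w ∈ K →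
      S.card ≤ ((D w).filter (G.Adj (φ (T.parent w))) \ K.image φ).card) →
    (∀ w ∈ S, T.parent w ∈ S → ∀ g ∈ D (T.parent w),
      S.card ≤ ((D w).filter (G.Adj g) \ K.image φ).card + 1) →
    ∃ ψ : W → V, (∀ w ∈ K, ψ w = φ w) ∧ Set.InjOn ψ (K ∪ S : Finset W) ∧
      ∀ w ∈ S, ψ w ∈ D w ∧ G.Adj (ψ w) (ψ (T.parent w)) := by
  induction n with
  | zero =>
    intro S hS _ _ _ _ _
    rw [Finset.card_eq_zero] at hS
    subst hS
    exact ⟨φ, fun _ _ => rfl, by simpa using hinj, by simp⟩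
  | succ n ih =>
    intro S hS hd hr hp hK hg
    obtain ⟨w, hw, hmax⟩ := Finset.exists_max_image S T.depth
      (Finset.card_pos.mp (by omega))
    have hne : ∀ v ∈ S, T.parent v ≠ w := fun v hv h => by
      have h1 := T.depth_parent_lt v (fun h => hr (h ▸ hv))
      have h2 := hmax v hv
      rw [h] at h1
      omega
    have hcard : (S.erase w).card = n := by rw [Finset.card_erase_of_mem hw]; omega
    have hwK : w ∉ K := fun h => Finset.disjoint_left.mp hd h hw
    obtain ⟨ψ, h1, h2, h3⟩ := ih (S.erase w) hcard
      (hd.mono_right (Finset.erase_subset _ _))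
      (fun h => hr (Finset.mem_of_mem_erase h))
      (fun v hv => by
        have := hp v (Finset.mem_of_mem_erase hv)
        have := hne v (Finset.mem_of_mem_erase hv)
        simp only [Finset.mem_union, Finset.mem_erase] at *
        tauto)
      (fun v hv hvK => by
        have := hK v (Finset.mem_of_mem_erase hv) hvK
        omega)
      (fun v hv hvS g hgD => by
        have := hg v (Finset.mem_of_mem_erase hv) (Finset.mem_of_mem_erase hvS) g hgD
        omega)
    have himg : K.image ψ = K.image φ := Finset.image_congr (fun v hv => h1 v hv)
    obtain ⟨x, hxD, hxadj, hxK, hxS⟩ : ∃ x ∈ D w, G.Adj (ψ (T.parent w)) x ∧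
        x ∉ K.image φ ∧ x ∉ (S.erase w).image ψ := by
      have hcase : ((S.erase w).image ψ ∩
          ((D w).filter (G.Adj (ψ (T.parent w))) \ K.image φ)).card <
          ((D w).filter (G.Adj (ψ (T.parent w))) \ K.image φ).card := by
        have hle : ((S.erase w).image ψ).card ≤ n := hcard ▸ Finset.card_image_le
        by_cases hpK : T.parent w ∈ K
        · have := hK w hw hpK
          rw [h1 _ hpK]
          have := Finset.card_le_card (Finset.inter_subset_left (s₁ := (S.erase w).image ψ)
            (s₂ := (D w).filter (G.Adj (φ (T.parent w))) \ K.image φ))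
          omega
        · have hpS : T.parent w ∈ S := by
            have := hp w hw
            simp only [Finset.mem_union] at this
            tauto
          have hpS' : T.parent w ∈ S.erase w := Finset.mem_erase.mpr ⟨hne w hw, hpS⟩
          have h5 := hg w hw hpS (ψ (T.parent w)) (h3 _ hpS').1
          have h6 : ((S.erase w).image ψ ∩
              ((D w).filter (G.Adj (ψ (T.parent w))) \ K.image φ)) ⊆
              ((S.erase w).image ψ).erase (ψ (T.parent w)) := by
            intro x hx
            simp only [Finset.mem_inter, Finset.mem_sdiff, Finset.mem_filter] at hx
            exact Finset.mem_erase.mpr ⟨fun h => G.loopless.irrefl x (h ▸ hx.2.1.2), hx.1⟩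
          have h7 := Finset.card_le_card h6
          rw [Finset.card_erase_of_mem (Finset.mem_image_of_mem _ hpS')] at h7
          have : 0 < ((S.erase w).image ψ).card :=
            Finset.card_pos.mpr ⟨_, Finset.mem_image_of_mem _ hpS'⟩
          omega
      by_contra! hcon
      refine absurd hcase (not_lt.mpr (Finset.card_le_card fun x hx => ?_))
      have hx' := hx
      simp only [Finset.mem_sdiff, Finset.mem_filter] at hx
      exact Finset.mem_inter.mpr ⟨hcon x hx.1.1 hx.1.2 hx.2, hx'⟩
    refine ⟨Function.update ψ w x, ?_, ?_, ?_⟩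
    · intro v hv
      rw [Function.update_of_ne (by rintro rfl; exact hwK hv), h1 v hv]
    · have hnew : ∀ v ∈ K ∪ S, v ≠ w → ψ v ≠ x := by
        intro v hv hvw hvx
        rcases Finset.mem_union.mp hv with h | h
        · exact hxK (Finset.mem_image.mpr ⟨v, h, by rw [← h1 v h, hvx]⟩)
        · exact hxS (Finset.mem_image.mpr ⟨v, Finset.mem_erase.mpr ⟨hvw, h⟩, hvx⟩)
      intro a ha b hb hab
      by_cases haw : a = w <;> by_cases hbw : b = w
      · rw [haw, hbw]
      · subst haw
        rw [Function.update_self, Function.update_of_ne hbw] at hab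
        exact absurd hab.symm (hnew b hb hbw)
      · subst hbw
        rw [Function.update_self, Function.update_of_ne haw] at hab
        exact absurd hab (hnew a ha haw)
      · rw [Function.update_of_ne haw, Function.update_of_ne hbw] at hab
        refine h2 ?_ ?_ hab
        · have := Finset.mem_coe.mp ha
          simp only [Finset.coe_union, Set.mem_union, Finset.mem_coe, Finset.mem_union,
            Finset.mem_erase] at *
          tauto
        · have := Finset.mem_coe.mp hb
          simp only [Finset.coe_union, Set.mem_union, Finset.mem_coe, Finset.mem_union,
            Finset.mem_erase] at *
          tauto
    · intro v hv
      rw [Function.update_of_ne (hne v hv)]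
      by_cases hvw : v = w
      · subst hvw
        rw [Function.update_self]
        exact ⟨hxD, hxadj.symm⟩
      · rw [Function.update_of_ne hvw]
        exact h3 v (Finset.mem_erase.mpr ⟨hvw, hv⟩)

lemma hasCopy_of_degree [Fintype W] {Z : Finset V} (hZ : Z.Nonempty)
    (hdeg : ∀ z ∈ Z, Fintype.card W ≤ (Z.filter (G.Adj z)).card + 1) : T.HasCopy G Z := by
  obtain ⟨z0, hz0⟩ := hZ
  have hself : ∀ g, g = z0 → (Z.filter (G.Adj g)) \ ({T.root} : Finset W).image (fun _ => z0) =
      Z.filter (G.Adj g) := by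
    rintro g rfl
    ext x
    simp only [Finset.image_singleton, Finset.mem_sdiff, Finset.mem_filter, Finset.mem_singleton]
    refine ⟨fun h => h.1, fun h => ⟨h, fun hx => ?_⟩⟩
    subst hx
    exact G.loopless.irrefl _ h.2
  have hone : 0 < Fintype.card W := Fintype.card_pos_iff.mpr ⟨T.root⟩
  have hc : (Finset.univ.erase T.root).card = Fintype.card W - 1 := by
    rw [Finset.card_erase_of_mem (Finset.mem_univ _), Finset.card_univ]
  obtain ⟨ψ, h1, h2, h3⟩ := greedy_extension (T := T) (G := G) (fun _ => Z) (fun _ => z0)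
    {T.root} (by simp) _ (Finset.univ.erase T.root) rfl (by simp) (by simp)
    (by intro w _; by_cases h : T.parent w = T.root <;> simp [h])
    (by
      intro w _ _
      rw [hself _ rfl, hc]
      have := hdeg z0 hz0
      omega)
    (by
      intro w _ _ g hg
      have := hdeg g hg
      have h4 := Finset.le_card_sdiff (({T.root} : Finset W).image (fun _ => z0))
        (Z.filter (G.Adj g))
      rw [Finset.image_singleton, Finset.card_singleton] at h4
      rw [hc, Finset.image_singleton]
      by_cases hz : z0 ∈ Z.filter (G.Adj g)
      · omega
      · rw [Finset.sdiff_singleton_eq_erase, Finset.erase_eq_of_notMem hz]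
        omega)
  refine ⟨ψ, fun a b hab => h2 (by simp) (by simp) hab,
    fun w hw => (h3 w (by simp [hw])).2, fun w => ?_⟩
  by_cases hw : w = T.root
  · rw [hw, h1 _ (by simp)]; exact hz0
  · exact (h3 w (by simp [hw])).1

end

end ParentTree

namespace ParentTree

section

open scoped Classical

variable {W V : Type*} {T : ParentTree W} {G : SimpleGraph V}

/-- Moving the branch of `T` below `t` off the vertex `φ t`, starting at a free vertex `z`. -/
lemma IsEmb.exists_move_branch [Fintype W] {Z A : Finset V} {φ : W → V} (hφ : T.IsEmb G Z φ)
    (hA : ∀ a ∈ A, ∃ w, φ w = a)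
    (hdeg : ∀ z ∈ Z, z ∉ A → Fintype.card W ≤ (Z.filter (G.Adj z)).card)
    {t : W} (ht : t ≠ T.root) (htA : ∀ w, T.Desc t w → φ w ∉ A)
    {z : V} (hz : z ∈ Z) (hzφ : ∀ w, φ w ≠ z) (hadj : G.Adj z (φ (T.parent t))) :
    ∃ ψ, T.IsEmb G Z ψ ∧ (∀ w, ¬ T.Desc t w → ψ w = φ w) ∧ ∀ w, ψ w ≠ φ t := by
  have hzA : z ∉ A := fun h => by
    obtain ⟨w, hw⟩ := hA z h
    exact hzφ w hw
  set φ' := Function.update φ t z with hφ'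
  have hφ't : φ' t = z := Function.update_self ..
  have hφ'n : ∀ w, w ≠ t → φ' w = φ w := fun w hw => Function.update_of_ne hw ..
  set K : Finset W := Finset.univ.filter fun w => T.Desc t w → w = t with hK
  set S : Finset W := Finset.univ.filter fun w => T.Desc t w ∧ w ≠ t with hS
  have hKS : K ∪ S = Finset.univ := by
    ext w; simp [hK, hS]; tauto
  have hdis : Disjoint K S := by
    rw [Finset.disjoint_left]; intro w; simp [hK, hS]
  have hsum : K.card + S.card = Fintype.card W := by
    rw [← Finset.card_union_of_disjoint hdis, hKS, Finset.card_univ]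
  have htK : t ∈ K := by simp [hK]
  have hinj' : Function.Injective φ' := by
    intro a b hab
    by_cases ha : a = t <;> by_cases hb : b = t
    · rw [ha, hb]
    · rw [ha, hφ't, hφ'n b hb] at hab; exact absurd hab.symm (hzφ b)
    · rw [hb, hφ't, hφ'n a ha] at hab; exact absurd hab (hzφ a)
    · rw [hφ'n a ha, hφ'n b hb] at hab; exact hφ.inj hab
  have hKcard : (K.image φ').card = K.card := Finset.card_image_of_injective _ hinj'
  have hAK : ∀ a ∈ A, a ∈ K.image φ' := by
    intro a ha
    obtain ⟨w, rfl⟩ := hA a ha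
    have hw : ¬ T.Desc t w := fun h => htA w h ha
    refine Finset.mem_image.mpr ⟨w, by simp [hK, hw], hφ'n w ?_⟩
    rintro rfl
    exact hw (Desc.refl _)
  have hzK : z ∈ K.image φ' := Finset.mem_image.mpr ⟨t, htK, hφ't⟩
  set D : Finset V := (Z \ A).erase (φ t) with hD
  have hsub : ∀ g, (Z.filter (G.Adj g)) ⊆
      ((D.filter (G.Adj g)) \ K.image φ') ∪ insert (φ t) (K.image φ') := by
    intro g x hx
    simp only [Finset.mem_filter] at hx
    by_cases h1 : x ∈ insert (φ t) (K.image φ')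
    · exact Finset.mem_union_right _ h1
    · refine Finset.mem_union_left _ ?_
      simp only [Finset.mem_insert, not_or] at h1
      simp only [hD, Finset.mem_sdiff, Finset.mem_filter, Finset.mem_erase]
      exact ⟨⟨⟨h1.1, hx.1, fun h => h1.2 (hAK x h)⟩, hx.2⟩, h1.2⟩
  obtain ⟨ψ, h1, h2, h3⟩ := greedy_extension (T := T) (G := G) (fun _ => D) φ' K
    hinj'.injOn _ S rfl hdis
    (by
      simp only [hS, Finset.mem_filter, Finset.mem_univ, true_and, not_and, not_not]
      intro h
      by_contra hne
      exact (h.parent hne).1 rfl)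
    (by intro w _; rw [hKS]; exact Finset.mem_univ _)
    (by
      intro w hw hwK
      simp only [hS, hK, Finset.mem_filter, Finset.mem_univ, true_and] at hw hwK
      rw [hwK (hw.1.parent hw.2).2, hφ't]
      have h5 : (Z.filter (G.Adj z)) ⊆
          ((D.filter (G.Adj z)) \ K.image φ') ∪ (insert (φ t) ((K.image φ').erase z)) := by
        intro x hx
        have := hsub z hx
        simp only [Finset.mem_filter] at hx
        have hxz : x ≠ z := fun h => G.loopless.irrefl z (h ▸ hx.2)
        simp only [Finset.mem_union, Finset.mem_insert, Finset.mem_erase] at this ⊢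
        tauto
      have h6 := (Finset.card_le_card h5).trans (Finset.card_union_le _ _)
      have h7 := Finset.card_insert_le (φ t) ((K.image φ').erase z)
      rw [Finset.card_erase_of_mem hzK, hKcard] at h7
      have h8 := hdeg z hz hzA
      have h9 : 0 < K.card := Finset.card_pos.mpr ⟨t, htK⟩
      omega)
    (by
      intro w _ _ g hg
      simp only [hD, Finset.mem_erase, Finset.mem_sdiff] at hg
      have h6 := (Finset.card_le_card (hsub g)).trans (Finset.card_union_le _ _)
      have h7 := Finset.card_insert_le (φ t) (K.image φ')
      rw [hKcard] at h7
      have h8 := hdeg g hg.2.1 hg.2.2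
      omega)
  have hψK : ∀ w, ¬ T.Desc t w → ψ w = φ w := by
    intro w hw
    rw [h1 w (by simp [hK, hw]), hφ'n w (by rintro rfl; exact hw (Desc.refl _))]
  have hψt : ψ t = z := by rw [h1 t htK, hφ't]
  have hmemS : ∀ w, T.Desc t w → w ≠ t → w ∈ S := fun w h h' => by simp [hS, h, h']
  refine ⟨ψ, ⟨fun a b hab => h2 (by rw [hKS]; simp) (by rw [hKS]; simp) hab, ?_, ?_⟩, hψK, ?_⟩
  · intro w hw
    by_cases hwt : w = t
    · subst hwt
      rw [hψt, hψK]
      · exact hadj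
      · intro h
        have := h.depth_le
        have := T.depth_parent_lt w hw
        omega
    · by_cases hd : T.Desc t w
      · exact (h3 w (hmemS w hd hwt)).2
      · rw [hψK w hd, hψK]
        · exact hφ.adj w hw
        · exact fun h => hd (h.trans (desc_of_parent hw rfl))
  · intro w
    by_cases hd : T.Desc t w
    · by_cases hwt : w = t
      · rw [hwt, hψt]; exact hz
      · have := (h3 w (hmemS w hd hwt)).1
        simp only [hD, Finset.mem_erase, Finset.mem_sdiff] at this
        exact this.2.1
    · rw [hψK w hd]; exact hφ.mem w
  · intro w
    by_cases hd : T.Desc t w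
    · by_cases hwt : w = t
      · rw [hwt, hψt]; exact (hzφ t).symm
      · have := (h3 w (hmemS w hd hwt)).1
        simp only [hD, Finset.mem_erase, Finset.mem_sdiff] at this
        exact this.1
    · rw [hψK w hd]
      intro h
      exact hd (hφ.inj h ▸ Desc.refl _)

end

end ParentTree

namespace ParentTree

section

open scoped Classical

variable {W V : Type*} {T : ParentTree W} {G : SimpleGraph V}

/-- Re-embedding the whole branch of `T` below `y`: its non-leaves go into `Y`, its leaves anywhere
but to `φ w₀`. -/
lemma IsEmb.hasCopy_erase_of_branch [Fintype W] {Z Y : Finset V} {φ : W → V}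
    (hφ : T.IsEmb G Z φ) {y w0 : W} {f : V} (hfφ : ∀ w, φ w ≠ f)
    (hyf : y ≠ T.root → G.Adj f (φ (T.parent y))) (hw0 : T.Desc y w0) (hw0Y : φ w0 ∉ Y)
    (hYZ : ∀ z ∈ Y, z ∈ Z) (hYφ : ∀ z ∈ Y, ∀ w, ¬ T.Desc y w → φ w ≠ z) (hfY : f ∈ Y)
    (hdeg : ∀ z ∈ Y, Fintype.card W ≤ (Z.filter (G.Adj z)).card)
    (hdegY : ∀ g ∈ Y, (Finset.univ.filter (T.Desc y)).card ≤ (Y.filter (G.Adj g)).card +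
      ((Finset.univ.filter (T.Desc y)).filter
        fun l => ∀ w, w ≠ T.root → T.parent w ≠ l).card) :
    T.HasCopy G (Z.erase (φ w0)) := by
  let leaf : W → Prop := fun l => ∀ w, w ≠ T.root → T.parent w ≠ l
  set B : Finset W := Finset.univ.filter (T.Desc y) with hB
  set L : Finset W := B.filter leaf with hL
  set φ' := Function.update φ y f with hφ'
  have hφ'y : φ' y = f := Function.update_self ..
  have hφ'n : ∀ w, w ≠ y → φ' w = φ w := fun w hw => Function.update_of_ne hw ..
  have hinj' : Function.Injective φ' := by
    intro a b hab
    by_cases ha : a = y <;> by_cases hb : b = y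
    · rw [ha, hb]
    · rw [ha, hφ'y, hφ'n b hb] at hab; exact absurd hab.symm (hfφ b)
    · rw [hb, hφ'y, hφ'n a ha] at hab; exact absurd hab (hfφ a)
    · rw [hφ'n a ha, hφ'n b hb] at hab; exact hφ.inj hab
  set K : Finset W := Finset.univ.filter fun w => T.Desc y w → w = y with hK
  set S : Finset W := Finset.univ.filter fun w => T.Desc y w ∧ w ≠ y ∧ ¬ leaf w with hS
  set R : Finset W := Finset.univ.filter fun w => T.Desc y w ∧ w ≠ y ∧ leaf w with hR
  have memK : ∀ w, w ∈ K ↔ (T.Desc y w → w = y) := fun w => by simp [hK]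
  have memS : ∀ w, w ∈ S ↔ T.Desc y w ∧ w ≠ y ∧ ¬ leaf w := fun w => by simp [hS]
  have memR : ∀ w, w ∈ R ↔ T.Desc y w ∧ w ≠ y ∧ leaf w := fun w => by simp [hR]
  have hdisS : Disjoint K S := Finset.disjoint_left.mpr fun w h1 h2 =>
    ((memS w).mp h2).2.1 ((memK w).mp h1 ((memS w).mp h2).1)
  have hdisR : Disjoint (K ∪ S) R := Finset.disjoint_left.mpr fun w h1 h2 => by
    obtain ⟨h3, h4, h5⟩ := (memR w).mp h2
    rcases Finset.mem_union.mp h1 with h | h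
    · exact h4 ((memK w).mp h h3)
    · exact ((memS w).mp h).2.2 h5
  have hcover : ∀ w, w ∉ K ∪ S → w ∈ R := fun w hw => by
    have h1 : ¬ (T.Desc y w → w = y) := fun h => hw (Finset.mem_union_left _ ((memK w).mpr h))
    obtain ⟨h2, h3⟩ := Classical.not_imp.mp h1
    exact (memR w).mpr ⟨h2, h3, not_not.mp fun h =>
      hw (Finset.mem_union_right _ ((memS w).mpr ⟨h2, h3, h⟩))⟩
  have huniv : K ∪ S ∪ R = Finset.univ := Finset.eq_univ_of_forall fun w => by
    by_cases h : w ∈ K ∪ S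
    · exact Finset.mem_union_left _ h
    · exact Finset.mem_union_right _ (hcover w h)
  have hpar : ∀ w, T.Desc y w → w ≠ y → T.parent w ∈ K ∪ S := by
    intro w h1 h2
    obtain ⟨h3, h4⟩ := h1.parent h2
    simp only [hK, hS, Finset.mem_union, Finset.mem_filter, Finset.mem_univ, true_and]
    by_cases h5 : T.parent w = y
    · exact Or.inl fun _ => h5
    · exact Or.inr ⟨h4, h5, fun hl => hl w h3 rfl⟩
  have hKdesc : ∀ w, T.Desc y w → w ≠ y → T.parent w ∈ K → T.parent w = y := by
    intro w h1 h2 h3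
    simp only [hK, Finset.mem_filter, Finset.mem_univ, true_and] at h3
    exact h3 (h1.parent h2).2
  have hYK : ∀ x ∈ Y, x ∈ K.image φ' → x = f := by
    intro x hx hxK
    obtain ⟨w, hw, rfl⟩ := Finset.mem_image.mp hxK
    by_cases hwy : w = y
    · rw [hwy, hφ'y]
    · simp only [hK, Finset.mem_filter, Finset.mem_univ, true_and] at hw
      rw [hφ'n w hwy] at hx
      exact absurd rfl (hYφ _ hx w fun h => hwy (hw h))
  have hScard : S.card + L.card ≤ B.card := by
    rw [← Finset.card_union_of_disjoint]
    · refine Finset.card_le_card (Finset.union_subset (fun w hw => ?_) (Finset.filter_subset _ _))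
      simp [hB, ((memS w).mp hw).1]
    · exact Finset.disjoint_left.mpr fun w h1 h2 =>
        ((memS w).mp h1).2.2 (Finset.mem_filter.mp h2).2
  obtain ⟨ψ, h1, h2, h3⟩ := greedy_extension (T := T) (G := G) (fun _ => Y) φ' K
    hinj'.injOn _ S rfl
    hdisS
    (by
      simp only [hS, Finset.mem_filter, Finset.mem_univ, true_and]
      rintro ⟨h, h', _⟩
      exact (h.parent h').1 rfl)
    (by
      intro w hw
      simp only [hS, Finset.mem_filter, Finset.mem_univ, true_and] at hw
      exact hpar w hw.1 hw.2.1)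
    (by
      intro w hw hwK
      simp only [hS, Finset.mem_filter, Finset.mem_univ, true_and] at hw
      rw [hKdesc w hw.1 hw.2.1 hwK, hφ'y, Finset.sdiff_eq_self_of_disjoint]
      · have := hdegY f hfY
        omega
      · rw [Finset.disjoint_left]
        intro x hx hxK
        simp only [Finset.mem_filter] at hx
        have := hYK x hx.1 hxK
        subst this
        exact G.loopless.irrefl _ hx.2)
    (by
      intro w _ _ g hg
      have h4 := hdegY g hg
      have h5 : Y.filter (G.Adj g) ⊆ (Y.filter (G.Adj g) \ K.image φ') ∪ {f} := by
        intro x hx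
        by_cases hxK : x ∈ K.image φ'
        · exact Finset.mem_union_right _
            (Finset.mem_singleton.mpr (hYK x (Finset.mem_filter.mp hx).1 hxK))
        · exact Finset.mem_union_left _ (Finset.mem_sdiff.mpr ⟨hx, hxK⟩)
      have h6 := (Finset.card_le_card h5).trans (Finset.card_union_le _ _)
      rw [Finset.card_singleton] at h6
      omega)
  have hyK : y ∈ K := by simp [hK]
  have hψKS : ∀ w, w ∈ K ∪ S → T.Desc y w → ψ w ∈ Y := by
    intro w hw hyw
    rcases Finset.mem_union.mp hw with h | h
    · simp only [hK, Finset.mem_filter, Finset.mem_univ, true_and] at h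
      rw [h hyw, h1 y hyK, hφ'y]
      exact hfY
    · exact (h3 w h).1
  have hsum : (K ∪ S).card + R.card = Fintype.card W := by
    rw [← Finset.card_union_of_disjoint hdisR, huniv, Finset.card_univ]
  obtain ⟨χ, k1, k2, k3⟩ := greedy_extension (T := T) (G := G) (fun _ => Z.erase (φ w0)) ψ (K ∪ S)
    h2 _ R rfl hdisR
    (by
      simp only [hR, Finset.mem_filter, Finset.mem_univ, true_and]
      rintro ⟨h, h', _⟩
      exact (h.parent h').1 rfl)
    (by
      intro w hw
      simp only [hR, Finset.mem_filter, Finset.mem_univ, true_and] at hw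
      exact Finset.mem_union_left _ (hpar w hw.1 hw.2.1))
    (by
      intro w hw hwK
      simp only [hR, Finset.mem_filter, Finset.mem_univ, true_and] at hw
      set g := ψ (T.parent w) with hg
      have hgY : g ∈ Y := hψKS _ hwK (hw.1.parent hw.2.1).2
      have h4 := hdeg g hgY
      have h5 : Z.filter (G.Adj g) ⊆ ((Z.erase (φ w0)).filter (G.Adj g) \ (K ∪ S).image ψ) ∪
          insert (φ w0) (((K ∪ S).image ψ).erase g) := by
        intro x hx
        simp only [Finset.mem_filter] at hx
        have hxg : x ≠ g := fun h => G.loopless.irrefl x (h ▸ hx.2)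
        by_cases h6 : x ∈ insert (φ w0) (((K ∪ S).image ψ).erase g)
        · exact Finset.mem_union_right _ h6
        · simp only [Finset.mem_insert, Finset.mem_erase, not_or, not_and] at h6
          exact Finset.mem_union_left _ (Finset.mem_sdiff.mpr
            ⟨Finset.mem_filter.mpr ⟨Finset.mem_erase.mpr ⟨h6.1, hx.1⟩, hx.2⟩, h6.2 hxg⟩)
      have h6 := (Finset.card_le_card h5).trans (Finset.card_union_le _ _)
      have h7 := Finset.card_insert_le (φ w0) (((K ∪ S).image ψ).erase g)
      rw [Finset.card_erase_of_mem (Finset.mem_image_of_mem _ hwK)] at h7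
      have h8 := Finset.card_image_le (s := K ∪ S) (f := ψ)
      have h9 : 0 < ((K ∪ S).image ψ).card :=
        Finset.card_pos.mpr ⟨g, Finset.mem_image_of_mem _ hwK⟩
      omega)
    (by
      intro w hw hwR
      simp only [hR, Finset.mem_filter, Finset.mem_univ, true_and] at hw hwR
      exact absurd rfl (hwR.2.2 w (hw.1.parent hw.2.1).1))
  have hχn : ∀ w, ¬ T.Desc y w → χ w = φ w := by
    intro w hw
    have hwK : w ∈ K := by simp [hK, hw]
    rw [k1 w (Finset.mem_union_left _ hwK), h1 w hwK,
      hφ'n w (by rintro rfl; exact hw (Desc.refl _))]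
  have hχ : ∀ w, χ w ∈ Z.erase (φ w0) := by
    intro w
    by_cases hw : T.Desc y w
    · by_cases hwK : w ∈ K ∪ S
      · rw [k1 w hwK]
        have := hψKS w hwK hw
        refine Finset.mem_erase.mpr ⟨fun h => hw0Y (h ▸ this), hYZ _ this⟩
      · exact (k3 w (hcover w hwK)).1
    · rw [hχn w hw]
      exact Finset.mem_erase.mpr ⟨fun h => hw (hφ.inj h ▸ hw0), hφ.mem w⟩
  refine ⟨χ, fun a b hab => k2 (by rw [huniv]; simp) (by rw [huniv]; simp) hab, ?_, hχ⟩
  intro w hw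
  by_cases hyw : T.Desc y w
  · by_cases hwy : w = y
    · subst hwy
      rw [k1 w (Finset.mem_union_left _ hyK), h1 w hyK, hφ'y, hχn]
      · exact hyf hw
      · intro h
        have := h.depth_le
        have := T.depth_parent_lt w hw
        omega
    · by_cases hwS : w ∈ S
      · rw [k1 w (Finset.mem_union_right _ hwS), k1 _ (hpar w hyw hwy)]
        exact (h3 w hwS).2
      · refine (k3 w (hcover w fun h => ?_)).2
        rcases Finset.mem_union.mp h with h | h
        · exact hwy ((memK w).mp h hyw)
        · exact hwS h
  · rw [hχn w hyw, hχn _ fun h => hyw (h.trans (desc_of_parent hw rfl))]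
    exact hφ.adj w hw

/-- If all vertices of `Z` outside `A` have degree at least `|T|` in `Z`, then not all copies of `T`
in `Z` contain `A`. -/
theorem exists_hasCopy_erase [Fintype W] {Z A : Finset V} (hA : A.Nonempty)
    (hT : T.HasCopy G Z) (hcard : Fintype.card W < Z.card)
    (hdeg : ∀ z ∈ Z, z ∉ A → Fintype.card W ≤ (Z.filter (G.Adj z)).card) :
    ∃ a ∈ A, T.HasCopy G (Z.erase a) := by
  by_contra! hcon
  have hall : ∀ φ, T.IsEmb G Z φ → ∀ a ∈ A, ∃ w, φ w = a := by
    intro φ hφ a ha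
    by_contra! h
    exact hcon a ha ⟨φ, hφ.inj, hφ.adj, fun w => Finset.mem_erase.mpr ⟨h w, hφ.mem w⟩⟩
  have hfree : ∀ φ, T.IsEmb G Z φ → ∃ f ∈ Z, ∀ w, φ w ≠ f := by
    intro φ hφ
    by_contra! h
    have h1 : Z ⊆ Finset.univ.image φ := fun z hz => by
      obtain ⟨w, hw⟩ := h z hz
      exact Finset.mem_image.mpr ⟨w, Finset.mem_univ _, hw⟩
    have := (Finset.card_le_card h1).trans Finset.card_image_le
    rw [Finset.card_univ] at this
    omega
  let Adm : W → Prop := fun y => ∃ φ f, T.IsEmb G Z φ ∧ f ∈ Z ∧ (∀ w, φ w ≠ f) ∧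
    (y ≠ T.root → G.Adj f (φ (T.parent y))) ∧ ∃ w, T.Desc y w ∧ φ w ∈ A
  have hroot : Adm T.root := by
    obtain ⟨φ, hφ⟩ := hT
    obtain ⟨f, hf, hfφ⟩ := hfree φ hφ
    obtain ⟨a, ha⟩ := hA
    obtain ⟨w, rfl⟩ := hall φ hφ a ha
    exact ⟨φ, f, hφ, hf, hfφ, fun h => absurd rfl h, w, desc_root w, ha⟩
  obtain ⟨y, hy, hymax⟩ := Finset.exists_max_image (Finset.univ.filter Adm) T.depth
    ⟨T.root, by simpa using hroot⟩
  simp only [Finset.mem_filter, Finset.mem_univ, true_and] at hy hymax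
  obtain ⟨φ, f, hφ, hf, hfφ, hyf, w0, hw0, hw0A⟩ := hy
  let P : Finset W → Prop := fun Q => (∀ w, ¬ T.Desc y w → w ∈ Q) ∧
    (∀ w ∈ Q, w ≠ T.root → T.parent w ∈ Q) ∧ (∀ w, φ w ∈ A → w ∈ Q) ∧
    ∀ t, t ∉ Q → ∃ ψ, T.IsEmb G Z ψ ∧ (∀ w ∈ Q, ψ w = φ w) ∧ ∀ w, ψ w ≠ φ t
  obtain ⟨Q, hQ, hQmin⟩ := Finset.exists_min_image (Finset.univ.filter P) Finset.card
    ⟨Finset.univ, by simp [P]⟩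
  simp only [Finset.mem_filter, Finset.mem_univ, true_and] at hQ hQmin
  obtain ⟨hQ1, hQ2, hQ3, hQ4⟩ := id hQ
  have hup : ∀ c d, T.Desc c d → d ∈ Q → c ∈ Q := by
    intro c d h
    induction h with
    | refl => exact id
    | tail _ h ih => exact fun hd => ih (h.2 ▸ hQ2 _ hd h.1)
  set Y : Finset V := Z \ Q.image φ with hYdef
  have hY : ∀ z ∈ Y, ∃ ψ, T.IsEmb G Z ψ ∧ (∀ w ∈ Q, ψ w = φ w) ∧ ∀ w, ψ w ≠ z := by
    intro z hz
    by_cases h : ∃ t, φ t = z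
    · obtain ⟨t, rfl⟩ := h
      refine hQ4 t fun ht => ?_
      exact (Finset.mem_sdiff.mp hz).2 (Finset.mem_image_of_mem _ ht)
    · push Not at h
      exact ⟨φ, hφ, fun _ _ => rfl, h⟩
  have hYZ : ∀ z ∈ Y, z ∈ Z := fun z hz => (Finset.mem_sdiff.mp hz).1
  have hYφ : ∀ z ∈ Y, ∀ w ∈ Q, φ w ≠ z := fun z hz w hw h =>
    (Finset.mem_sdiff.mp hz).2 (h ▸ Finset.mem_image_of_mem _ hw)
  have hYA : ∀ z ∈ Y, z ∉ A := by
    intro z hz hzA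
    obtain ⟨w, rfl⟩ := hall φ hφ z hzA
    exact hYφ _ hz w (hQ3 w hzA) rfl
  have hfY : f ∈ Y := by
    refine Finset.mem_sdiff.mpr ⟨hf, fun h => ?_⟩
    obtain ⟨w, _, hw⟩ := Finset.mem_image.mp h
    exact hfφ w hw
  have hmiss : ∀ z ∈ Y, ∀ n ∈ Q, T.Desc y n → (∃ t ∈ Q, t ≠ T.root ∧ T.parent t = n) →
      ¬ G.Adj z (φ n) := by
    rintro z hz n hn hyn ⟨t, htQ, htr, htn⟩ hadj
    obtain ⟨ψ, hψ, hψQ, hψz⟩ := hY z hz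
    by_cases hb : ∃ w, T.Desc n w ∧ w ≠ n ∧ φ w ∈ A
    · obtain ⟨w, hnw, hwn, hwA⟩ := hb
      rcases Relation.ReflTransGen.cases_head hnw with h | ⟨c, ⟨hc, hcn⟩, hcw⟩
      · exact hwn h.symm
      · have h1 : Adm c := ⟨ψ, z, hψ, hYZ z hz, hψz, fun _ => by rw [hcn, hψQ n hn]; exact hadj,
          w, hcw, by rw [hψQ w (hQ3 w hwA)]; exact hwA⟩
        have h2 := hymax c h1
        have h3 := T.depth_parent_lt c hc
        have h4 := hyn.depth_le
        rw [hcn] at h3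
        omega
    · push Not at hb
      obtain ⟨s, hs, hsmax⟩ := Finset.exists_max_image
        (Q.filter fun w => T.Desc n w ∧ w ≠ n) T.depth
        ⟨t, by
          simp only [Finset.mem_filter]
          refine ⟨htQ, desc_of_parent htr htn, fun h => ?_⟩
          have := T.depth_parent_lt t htr
          rw [htn, h] at this
          omega⟩
      simp only [Finset.mem_filter] at hs hsmax
      obtain ⟨hsQ, hns, hsn⟩ := hs
      obtain ⟨hsr, hnps⟩ := hns.parent hsn
      have hpQ := hQ2 s hsQ hsr
      have hnoQ : ∀ w ∈ Q, T.Desc s w → w = s := by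
        intro w hw hsw
        by_contra hne
        have h1 := hsw.depth_lt hne
        have h2 := hsmax w ⟨hw, hns.trans hsw, fun h => by
          have := hns.depth_le
          rw [h] at h1
          omega⟩
        omega
      obtain ⟨z', hz', hz'ψ, hz'adj⟩ :
          ∃ z' ∈ Z, (∀ w, ψ w ≠ z') ∧ G.Adj z' (ψ (T.parent s)) := by
        by_cases hp : T.parent s = n
        · exact ⟨z, hYZ z hz, hψz, by rw [hψQ _ hpQ, hp]; exact hadj⟩
        · by_contra! hno
          have h1 := hdeg (ψ (T.parent s)) (hψ.mem _)
            (by rw [hψQ _ hpQ]; exact hb _ hnps hp)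
          have h2 : Z.filter (G.Adj (ψ (T.parent s))) ⊆
              (Finset.univ.image ψ).erase (ψ (T.parent s)) := by
            intro x hx
            simp only [Finset.mem_filter] at hx
            refine Finset.mem_erase.mpr ⟨fun h => G.loopless.irrefl x (h ▸ hx.2), ?_⟩
            by_contra hxi
            refine hno x hx.1 (fun w hw => hxi ?_) hx.2.symm
            exact Finset.mem_image.mpr ⟨w, Finset.mem_univ _, hw⟩
          have h3 := Finset.card_le_card h2
          rw [Finset.card_erase_of_mem (Finset.mem_image_of_mem _ (Finset.mem_univ _)),
            Finset.card_image_of_injective _ hψ.inj, Finset.card_univ] at h3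
          have : 0 < Fintype.card W := Fintype.card_pos_iff.mpr ⟨s⟩
          omega
      obtain ⟨ψ', hψ', hψ'1, hψ'2⟩ := hψ.exists_move_branch (hall ψ hψ) hdeg hsr
        (by
          intro w hsw hwA
          obtain ⟨v, hv⟩ := hall φ hφ _ hwA
          have hvQ := hQ3 v (by rw [hv]; exact hwA)
          rw [← hψQ v hvQ] at hv
          have hvw := hψ.inj hv
          subst hvw
          rw [hψQ v hvQ] at hwA
          have := hnoQ v hvQ hsw
          subst this
          exact hb v hns hsn hwA) hz' hz'ψ hz'adj
      have hP : P (Q.erase s) := by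
        refine ⟨fun w hw => Finset.mem_erase.mpr ⟨?_, hQ1 w hw⟩, ?_, ?_, ?_⟩
        · rintro rfl
          exact hw (hyn.trans hns)
        · intro w hw hwr
          refine Finset.mem_erase.mpr ⟨fun h => ?_, hQ2 w (Finset.mem_of_mem_erase hw) hwr⟩
          have := hnoQ w (Finset.mem_of_mem_erase hw) (desc_of_parent hwr h)
          exact (Finset.mem_erase.mp hw).1 this
        · intro w hw
          refine Finset.mem_erase.mpr ⟨?_, hQ3 w hw⟩
          rintro rfl
          exact hb w hns hsn hw
        · intro u hu
          by_cases hus : u = s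
          · subst hus
            refine ⟨ψ', hψ', fun w hw => ?_, fun w => by rw [← hψQ u hsQ]; exact hψ'2 w⟩
            have hw' := Finset.mem_erase.mp hw
            rw [hψ'1 w fun h => hw'.1 (hnoQ w hw'.2 h), hψQ w hw'.2]
          · obtain ⟨χ, h1, h2, h3⟩ := hQ4 u fun h => hu (Finset.mem_erase.mpr ⟨hus, h⟩)
            exact ⟨χ, h1, fun w hw => h2 w (Finset.mem_of_mem_erase hw), h3⟩
      have h1 := hQmin _ hP
      rw [Finset.card_erase_of_mem hsQ] at h1
      have : 0 < Q.card := Finset.card_pos.mpr ⟨s, hsQ⟩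
      omega
  let leaf : W → Prop := fun l => ∀ w, w ≠ T.root → T.parent w ≠ l
  set B : Finset W := Finset.univ.filter (T.Desc y) with hB
  set L : Finset W := B.filter leaf with hL
  let inner : W → Prop := fun n => ∃ t ∈ Q, t ≠ T.root ∧ T.parent t = n
  set C : Finset W := Q.filter (fun c => T.Desc y c ∧ ¬ inner c) with hC
  have hCL : C.card ≤ L.card := by
    choose lf hlf1 hlf2 using exists_leaf_desc (T := T)
    refine Finset.card_le_card_of_injOn lf ?_ ?_
    · intro c hc
      simp only [hC, Finset.coe_filter, Set.mem_ofPred_eq] at hc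
      simp only [hL, hB, Finset.coe_filter, Finset.mem_filter, Finset.mem_univ, true_and,
        Set.mem_ofPred_eq]
      exact ⟨hc.2.1.trans (hlf1 c), hlf2 c⟩
    · have key : ∀ c d, c ∈ Q → d ∈ Q → ¬ inner c → T.Desc c d → c = d := by
        intro c d _ hd hci hcd
        rcases Relation.ReflTransGen.cases_head hcd with h | ⟨e, ⟨he, hec⟩, hed⟩
        · exact h
        · exact absurd ⟨e, hup e d hed hd, he, hec⟩ hci
      intro c hc d hd hcd
      simp only [hC, Finset.coe_filter, Set.mem_ofPred_eq] at hc hd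
      rcases (hlf1 c).total (hcd ▸ hlf1 d : T.Desc d (lf c)) with h | h
      · exact key c d hc.1 hd.1 hc.2.2 h
      · exact (key d c hd.1 hc.1 hd.2.2 h).symm
  have hLB : L.card ≤ B.card := Finset.card_le_card (Finset.filter_subset _ _)
  have hdegY : ∀ g ∈ Y, B.card ≤ (Y.filter (G.Adj g)).card + L.card := by
    intro g hg
    have h1 := hdeg g (hYZ g hg) (hYA g hg)
    have h2 : Z.filter (G.Adj g) ⊆ Y.filter (G.Adj g) ∪ (Bᶜ ∪ C).image φ := by
      intro x hx
      simp only [Finset.mem_filter] at hx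
      by_cases hxY : x ∈ Y
      · exact Finset.mem_union_left _ (Finset.mem_filter.mpr ⟨hxY, hx.2⟩)
      · have : x ∈ Q.image φ := by
          by_contra h
          exact hxY (Finset.mem_sdiff.mpr ⟨hx.1, h⟩)
        obtain ⟨q, hq, rfl⟩ := Finset.mem_image.mp this
        refine Finset.mem_union_right _ (Finset.mem_image_of_mem _ ?_)
        by_cases hyq : T.Desc y q
        · refine Finset.mem_union_right _ (Finset.mem_filter.mpr ⟨hq, hyq, fun h => ?_⟩)
          exact hmiss g hg q hq hyq h hx.2
        · exact Finset.mem_union_left _ (by simp [hB, hyq])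
    have h3 := (Finset.card_le_card h2).trans (Finset.card_union_le _ _)
    have h4 := (Finset.card_image_le (s := Bᶜ ∪ C) (f := φ)).trans (Finset.card_union_le _ _)
    have h5 := Finset.card_add_card_compl B
    omega
  exact hcon _ hw0A (hφ.hasCopy_erase_of_branch hfφ hyf hw0 (fun h => hYA _ h hw0A) hYZ
    (fun z hz w hw => hYφ z hz w (hQ1 w hw)) hfY (fun z hz => hdeg z (hYZ z hz) (hYA z hz)) hdegY)

end

end ParentTree

namespace SimpleGraph

section

open scoped Classical

variable {V : Type*} (G : SimpleGraph V)

/-- The subgraph of `G` induced on `R` is empty or connected. -/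
def ConnOn (R : Finset V) : Prop :=
  ∀ C : Set V, (∀ x ∈ R, ∀ y ∈ R, G.Adj x y → x ∈ C → y ∈ C) → ∀ a ∈ R, a ∈ C → ∀ b ∈ R, b ∈ C

/-- No two vertices of `K` are separated by at most two vertices in the subgraph of `G` induced
on `X`. -/
def Insep (K X : Finset V) : Prop :=
  K ⊆ X ∧ ∀ (S : Finset V) (C : Set V), S.card ≤ 2 →
    (∀ x ∈ X, x ∉ S → ∀ y ∈ X, y ∉ S → G.Adj x y → x ∈ C → y ∈ C) →
    ∀ a ∈ K, a ∉ S → a ∈ C → ∀ b ∈ K, b ∉ S → b ∈ C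

variable {G}

lemma connOn_singleton (z : V) : G.ConnOn {z} := by
  intro C _ a ha haC b hb
  rw [Finset.mem_singleton] at ha hb
  rw [hb, ← ha]; exact haC

lemma ConnOn.union {R R' : Finset V} (h : G.ConnOn R) (h' : G.ConnOn R') {z : V} (hz : z ∈ R)
    (hz' : z ∈ R') : G.ConnOn (R ∪ R') := by
  intro C hC a ha haC
  have h1 : ∀ a ∈ R, a ∈ C → ∀ b ∈ R, b ∈ C := h C fun x hx y hy =>
    hC x (Finset.mem_union_left _ hx) y (Finset.mem_union_left _ hy)
  have h2 : ∀ a ∈ R', a ∈ C → ∀ b ∈ R', b ∈ C := h' C fun x hx y hy =>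
    hC x (Finset.mem_union_right _ hx) y (Finset.mem_union_right _ hy)
  have hzC : z ∈ C := by
    rcases Finset.mem_union.mp ha with ha | ha
    · exact h1 a ha haC z hz
    · exact h2 a ha haC z hz'
  intro b hb
  rcases Finset.mem_union.mp hb with hb | hb
  · exact h1 z hz hzC b hb
  · exact h2 z hz' hzC b hb

lemma connOn_pair {x y : V} (h : G.Adj x y) : G.ConnOn {x, y} := by
  intro C hC a ha haC b hb
  simp only [Finset.mem_insert, Finset.mem_singleton] at ha hb
  have h1 := hC x (by simp) y (by simp) h
  have h2 := hC y (by simp) x (by simp) h.symm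
  rcases ha with rfl | rfl <;> rcases hb with rfl | rfl <;> tauto

lemma ConnOn.union_of_adj {R R' : Finset V} (h : G.ConnOn R) (h' : G.ConnOn R') {x y : V}
    (hx : x ∈ R) (hy : y ∈ R') (hxy : G.Adj x y) : G.ConnOn (R ∪ R') := by
  have h1 := (h.union (connOn_pair hxy) hx (by simp)).union h' (z := y) (by simp) hy
  have h2 : R ∪ {x, y} ∪ R' = R ∪ R' := by
    ext v
    simp only [Finset.mem_union, Finset.mem_insert, Finset.mem_singleton]
    constructor
    · rintro ((h | rfl | rfl) | h) <;> tauto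
    · tauto
  rwa [h2] at h1

lemma ConnOn.insert_of_adj {R : Finset V} (h : G.ConnOn R) {x y : V} (hx : x ∈ R)
    (hxy : G.Adj x y) : G.ConnOn (insert y R) := by
  rw [Finset.insert_eq, Finset.union_comm]
  exact h.union_of_adj (connOn_singleton y) hx (by simp) hxy

lemma ConnOn.exists_adj {R L : Finset V} (h : G.ConnOn R) (hL : L ⊆ R) (hne : L.Nonempty)
    (hLR : L ≠ R) : ∃ l ∈ L, ∃ x ∈ R, x ∉ L ∧ G.Adj l x := by
  by_contra! hcon
  obtain ⟨a, ha⟩ := hne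
  refine hLR (Finset.Subset.antisymm hL fun b hb => ?_)
  refine h (L : Set V) (fun x _ y hy hxy hxL => ?_) a (hL ha) ha b hb
  by_contra hyL
  exact hcon x hxL y hy hyL hxy

/-- The component of `r` in the subgraph induced on `R`. -/
lemma exists_component {R : Finset V} {r : V} (hr : r ∈ R) :
    ∃ L ⊆ R, r ∈ L ∧ G.ConnOn L ∧ ∀ l ∈ L, ∀ x ∈ R, G.Adj l x → x ∈ L := by
  obtain ⟨L, hL, hmax⟩ := Finset.exists_max_image
    (R.powerset.filter fun L => r ∈ L ∧ G.ConnOn L) Finset.card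
    ⟨{r}, by simp [hr, connOn_singleton]⟩
  simp only [Finset.mem_filter, Finset.mem_powerset] at hL hmax
  refine ⟨L, hL.1, hL.2.1, hL.2.2, fun l hl x hx hlx => ?_⟩
  by_contra hxL
  have := hmax (insert x L) ⟨Finset.insert_subset hx hL.1, Finset.mem_insert_of_mem hL.2.1,
    hL.2.2.insert_of_adj hl hlx⟩
  rw [Finset.card_insert_of_notMem hxL] at this
  omega

/-- A connected set with more than one vertex has a vertex other than `r` that does not
disconnect it. -/
lemma ConnOn.exists_erase {L : Finset V} (h : G.ConnOn L) {r : V} (hr : r ∈ L) (hne : L ≠ {r}) :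
    ∃ x ∈ L, x ≠ r ∧ G.ConnOn (L.erase x) := by
  obtain ⟨P, hP, hmax⟩ := Finset.exists_max_image
    (L.powerset.filter fun P => r ∈ P ∧ G.ConnOn P ∧ P ≠ L) Finset.card
    ⟨{r}, by simp [hr, connOn_singleton, hne.symm]⟩
  simp only [Finset.mem_filter, Finset.mem_powerset] at hP hmax
  obtain ⟨hPL, hrP, hPc, hPne⟩ := hP
  obtain ⟨l, hl, x, hx, hxP, hlx⟩ := h.exists_adj hPL ⟨r, hrP⟩ hPne
  have h1 : insert x P = L := by
    by_contra hcon
    have := hmax (insert x P) ⟨Finset.insert_subset hx hPL, Finset.mem_insert_of_mem hrP,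
      hPc.insert_of_adj hl hlx, hcon⟩
    rw [Finset.card_insert_of_notMem hxP] at this
    omega
  refine ⟨x, hx, fun h => hxP (h ▸ hrP), ?_⟩
  rw [← h1, Finset.erase_insert hxP]
  exact hPc

/-- A connected set containing `z` and `r` in which `z` has at most one neighbour. -/
lemma ConnOn.exists_path {R : Finset V} (h : G.ConnOn R) {z r : V} (hz : z ∈ R) (hr : r ∈ R) :
    ∃ P ⊆ R, z ∈ P ∧ r ∈ P ∧ G.ConnOn P ∧ (P.filter (G.Adj z)).card ≤ 1 := by
  by_cases hrz : r = z
  · subst hrz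
    exact ⟨{r}, by simpa using hr, by simp, by simp, connOn_singleton r,
      (Finset.card_filter_le _ _).trans (by simp)⟩
  obtain ⟨L0, hL0, hrL0, hL0c, hL0m⟩ := exists_component (G := G)
    (Finset.mem_erase.mpr ⟨hrz, hr⟩)
  have hL0z : ∃ l ∈ L0, G.Adj z l := by
    obtain ⟨l, hl, x, hx, hxL, hlx⟩ := h.exists_adj
      (hL0.trans (Finset.erase_subset _ _)) ⟨r, hrL0⟩
      (fun h => (Finset.mem_erase.mp (hL0 (h ▸ hz))).1 rfl)
    by_cases hxz : x = z
    · exact ⟨l, hl, hxz ▸ hlx.symm⟩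
    · exact absurd (hL0m l hl x (Finset.mem_erase.mpr ⟨hxz, hx⟩) hlx) hxL
  obtain ⟨L, hL, hmin⟩ := Finset.exists_min_image
    ((R.erase z).powerset.filter fun L => r ∈ L ∧ G.ConnOn L ∧ ∃ l ∈ L, G.Adj z l) Finset.card
    ⟨L0, by simp only [Finset.mem_filter, Finset.mem_powerset]; exact ⟨hL0, hrL0, hL0c, hL0z⟩⟩
  simp only [Finset.mem_filter, Finset.mem_powerset] at hL hmin
  obtain ⟨hLR, hrL, hLc, l, hlL, hzl⟩ := hL
  refine ⟨insert z L, Finset.insert_subset hz (hLR.trans (Finset.erase_subset _ _)),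
    Finset.mem_insert_self .., Finset.mem_insert_of_mem hrL, hLc.insert_of_adj hlL hzl.symm, ?_⟩
  have h1 : (insert z L).filter (G.Adj z) = L.filter (G.Adj z) := by
    rw [Finset.filter_insert, if_neg (G.loopless.irrefl z)]
  rw [h1]
  by_cases hLr : L = {r}
  · rw [hLr]
    exact (Finset.card_filter_le _ _).trans (by simp)
  · obtain ⟨x, hx, hxr, hxc⟩ := hLc.exists_erase hrL hLr
    refine Finset.card_le_one.mpr ?_
    have key : ∀ a ∈ L.filter (G.Adj z), a = x := by
      intro a ha
      rw [Finset.mem_filter] at ha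
      by_contra hax
      have := hmin (L.erase x) ⟨(Finset.erase_subset _ _).trans hLR,
        Finset.mem_erase.mpr ⟨hxr.symm, hrL⟩, hxc, a, Finset.mem_erase.mpr ⟨hax, ha.1⟩, ha.2⟩
      rw [Finset.card_erase_of_mem hx] at this
      have : 0 < L.card := Finset.card_pos.mpr ⟨x, hx⟩
      omega
    intro a ha b hb
    rw [key a ha, key b hb]

/-- Every set `S` of terminals attached to a connected set `R` is attached to a connected subset in
which a given vertex `z` has few neighbours. -/
lemma ConnOn.exists_fan {R : Finset V} (h : G.ConnOn R) {z : V} (hz : z ∈ R) (att : V → V → Prop)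
    (S : Finset V) (hS : ∀ s ∈ S, ∃ r ∈ R, att r s) :
    ∃ P ⊆ R, z ∈ P ∧ G.ConnOn P ∧ (∀ s ∈ S, ∃ p ∈ P, att p s) ∧
      (P.filter (G.Adj z)).card + (S.filter (att z)).card ≤ S.card := by
  induction S using Finset.induction_on with
  | empty =>
    refine ⟨{z}, by simpa using hz, by simp, connOn_singleton z, by simp, ?_⟩
    simp [Finset.filter_singleton]
  | insert s S hs ih =>
    obtain ⟨P, hPR, hzP, hPc, hPS, hcard⟩ := ih fun t ht => hS t (Finset.mem_insert_of_mem ht)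
    rw [Finset.card_insert_of_notMem hs, Finset.filter_insert]
    by_cases hzs : att z s
    · refine ⟨P, hPR, hzP, hPc, ?_, ?_⟩
      · intro t ht
        rcases Finset.mem_insert.mp ht with rfl | ht
        · exact ⟨z, hzP, hzs⟩
        · exact hPS t ht
      · rw [if_pos hzs, Finset.card_insert_of_notMem (by simp [hs])]
        omega
    · obtain ⟨r, hr, hrs⟩ := hS s (Finset.mem_insert_self ..)
      obtain ⟨P', hP'R, hzP', hrP', hP'c, hcard'⟩ := h.exists_path hz hr
      refine ⟨P ∪ P', Finset.union_subset hPR hP'R, Finset.mem_union_left _ hzP,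
        hPc.union hP'c hzP hzP', ?_, ?_⟩
      · intro t ht
        rcases Finset.mem_insert.mp ht with rfl | ht
        · exact ⟨r, Finset.mem_union_right _ hrP', hrs⟩
        · obtain ⟨p, hp, hpt⟩ := hPS t ht
          exact ⟨p, Finset.mem_union_left _ hp, hpt⟩
      · rw [if_neg hzs, Finset.filter_union]
        have := Finset.card_union_le (P.filter (G.Adj z)) (P'.filter (G.Adj z))
        omega

lemma ConnOn.erase_of_card_le_one {P : Finset V} (h : G.ConnOn P) {z : V}
    (hz : (P.filter (G.Adj z)).card ≤ 1) : G.ConnOn (P.erase z) := by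
  intro C hC a ha haC b hb
  have haP := (Finset.mem_erase.mp ha).2
  have hbP := (Finset.mem_erase.mp hb).2
  have h1 := h {x | (x ≠ z ∧ x ∈ C) ∨ (x = z ∧ ∃ y ∈ P, y ≠ z ∧ G.Adj z y ∧ y ∈ C)} ?_ a haP
    (Or.inl ⟨(Finset.mem_erase.mp ha).1, haC⟩) b hbP
  · rcases h1 with h1 | h1
    · exact h1.2
    · exact absurd h1.1 (Finset.mem_erase.mp hb).1
  · rintro x hx y hy hxy (⟨hxz, hxC⟩ | ⟨rfl, w, hw, hwx, hxw, hwC⟩)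
    · by_cases hyz : y = z
      · exact Or.inr ⟨hyz, x, hx, hxz, hyz ▸ hxy.symm, hxC⟩
      · exact Or.inl ⟨hyz, hC x (Finset.mem_erase.mpr ⟨hxz, hx⟩) y
          (Finset.mem_erase.mpr ⟨hyz, hy⟩) hxy hxC⟩
    · have : y = w := Finset.card_le_one.mp hz y (Finset.mem_filter.mpr ⟨hy, hxy⟩) w
        (Finset.mem_filter.mpr ⟨hw, hxw⟩)
      subst this
      exact Or.inl ⟨hwx, hwC⟩

lemma Insep.mono {K X X' : Finset V} (h : G.Insep K X) (hX : X ⊆ X') : G.Insep K X' :=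
  ⟨h.1.trans hX, fun S C hS hC => h.2 S C hS fun x hx hxS y hy hyS =>
    hC x (hX hx) hxS y (hX hy) hyS⟩

/-- A part `E` of `X` that is attached at no more than two vertices may be exchanged for any
connected set `Q` attached to both of them. -/
lemma Insep.replace {K X E S Q : Finset V} (h : G.Insep K X) (hK : 4 ≤ K.card)
    (hKE : Disjoint K E) (hS : S.card ≤ 2)
    (hES : ∀ e ∈ E, ∀ y ∈ X, y ∉ E → G.Adj e y → y ∈ S) (hQ : G.ConnOn Q)
    (hQX : ∀ q ∈ Q, q ∈ X → q ∈ E) (hSQ : 2 ≤ S.card → ∀ s ∈ S, ∃ q ∈ Q, G.Adj q s) : G.Insep K ((X \ E) ∪ Q) := by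
  have hKX : ∀ k ∈ K, k ∈ X ∧ k ∉ E := fun k hk => ⟨h.1 hk, Finset.disjoint_left.mp hKE hk⟩
  refine ⟨fun k hk => Finset.mem_union_left _ (Finset.mem_sdiff.mpr (hKX k hk)),
    fun S0 C hS0 hC a ha haS0 haC b hb hbS0 => ?_⟩
  have hCX : ∀ x ∈ X, x ∉ E → x ∉ S0 → ∀ y ∈ X, y ∉ E → y ∉ S0 → G.Adj x y → x ∈ C → y ∈ C :=
    fun x hx hxE hxS y hy hyE hyS => hC x (by simp [hx, hxE]) hxS y (by simp [hy, hyE]) hyS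
  -- reachability avoiding a set that leaves `E` at most one attachment
  have key : ∀ S1 : Finset V, S1.card ≤ 2 → (∀ x ∈ X, x ∉ E → x ∈ S0 → x ∈ S1) →
      ((S.filter (· ∉ S1)).card ≤ 1) → ∀ a ∈ K, a ∉ S1 → a ∈ C → ∀ b ∈ K, b ∉ S1 → b ∈ C := by
    intro S1 hS1 hS01 hSS1 a ha haS haC b hb hbS
    have h1 := h.2 S1 {x | (x ∉ E ∧ x ∈ C) ∨ (x ∈ E ∧ ∃ s ∈ S, s ∉ S1 ∧ s ∈ C)} hS1 ?_ a ha haS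
      (Or.inl ⟨(hKX a ha).2, haC⟩) b hb hbS
    · rcases h1 with h1 | h1
      · exact h1.2
      · exact absurd h1.1 (hKX b hb).2
    · rintro x hx hxS y hy hyS hxy (⟨hxE, hxC⟩ | ⟨hxE, s, hs, hsS, hsC⟩)
      · by_cases hyE : y ∈ E
        · exact Or.inr ⟨hyE, x, hES y hyE x hx hxE hxy.symm, hxS, hxC⟩
        · exact Or.inl ⟨hyE, hCX x hx hxE (fun h => hxS (hS01 x hx hxE h)) y hy hyE
            (fun h => hyS (hS01 y hy hyE h)) hxy hxC⟩
      · by_cases hyE : y ∈ E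
        · exact Or.inr ⟨hyE, s, hs, hsS, hsC⟩
        · have hyS' := hES x hxE y hy hyE hxy
          have : y = s := Finset.card_le_one.mp hSS1 y (by simp [hyS', hyS]) s (by simp [hs, hsS])
          subst this
          exact Or.inl ⟨hyE, hsC⟩
  by_cases hS1 : S.card ≤ 1
  · exact key S0 hS0 (fun _ _ _ h => h) ((Finset.card_filter_le _ _).trans hS1) a ha haS0 haC b hb
      hbS0
  by_cases hQS0 : ∃ q ∈ Q, q ∈ S0
  · obtain ⟨q, hqQ, hqS0⟩ := hQS0
    have hcard : (S0.filter (· ∉ Q)).card ≤ 1 := by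
      have h1 : S0.filter (· ∉ Q) ⊆ S0.erase q := by
        intro x hx
        rw [Finset.mem_filter] at hx
        exact Finset.mem_erase.mpr ⟨fun h => hx.2 (h ▸ hqQ), hx.1⟩
      have h2 := Finset.card_le_card h1
      rw [Finset.card_erase_of_mem hqS0] at h2
      omega
    have key' : ∀ s ∈ S, ∀ a ∈ K, a ≠ s → a ∉ S0.filter (· ∉ Q) → a ∈ C →
        ∀ b ∈ K, b ≠ s → b ∉ S0.filter (· ∉ Q) → b ∈ C := by
      intro s hs a ha has haS haC b hb hbs hbS
      refine key (insert s (S0.filter (· ∉ Q))) ((Finset.card_insert_le _ _).trans (by omega)) ?_ ?_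
        a ha (by simp only [Finset.mem_insert, not_or]; exact ⟨has, haS⟩) haC b hb
        (by simp only [Finset.mem_insert, not_or]; exact ⟨hbs, hbS⟩)
      · intro x hx hxE hxS
        exact Finset.mem_insert_of_mem (Finset.mem_filter.mpr ⟨hxS, fun h => hxE (hQX x h hx)⟩)
      · have h1 : S.filter (· ∉ insert s (S0.filter (· ∉ Q))) ⊆ S.erase s := by
          intro x hx
          rw [Finset.mem_filter] at hx
          exact Finset.mem_erase.mpr ⟨fun h => hx.2 (h ▸ Finset.mem_insert_self _ _), hx.1⟩
        have h2 := Finset.card_le_card h1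
        rw [Finset.card_erase_of_mem hs] at h2
        omega
    have haS' : a ∉ S0.filter (· ∉ Q) := fun h => haS0 (Finset.mem_filter.mp h).1
    have hbS' : b ∉ S0.filter (· ∉ Q) := fun h => hbS0 (Finset.mem_filter.mp h).1
    by_cases hs : ∃ s ∈ S, s ≠ a ∧ s ≠ b
    · obtain ⟨s, hs, hsa, hsb⟩ := hs
      exact key' s hs a ha hsa.symm haS' haC b hb hsb.symm hbS'
    · push Not at hs
      by_cases hab : b = a
      · exact hab ▸ haC
      have hSab : S ⊆ {a, b} := by
        intro s hs'
        by_cases hsa : s = a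
        · simp [hsa]
        · simp [hs s hs' hsa]
      have hSeq : S = {a, b} := Finset.eq_of_subset_of_card_le hSab
        (Finset.card_le_two.trans (by omega))
      obtain ⟨c, hc, hc'⟩ : ∃ c ∈ K, c ∉ {a, b} ∪ S0.filter (· ∉ Q) := by
        by_contra! hcon
        have h1 := Finset.card_le_card hcon
        have h2 := Finset.card_union_le {a, b} (S0.filter (· ∉ Q))
        have h3 : ({a, b} : Finset V).card ≤ 2 := Finset.card_le_two
        omega
      simp only [Finset.mem_union, Finset.mem_insert, Finset.mem_singleton, not_or] at hc'
      have hcC := key' b (by simp [hSeq]) a ha (Ne.symm hab) haS' haC c hc hc'.1.2 hc'.2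
      exact key' a (by simp [hSeq]) c hc hc'.1.1 hc'.2 hcC b hb hab hbS'
  · push Not at hQS0
    have h1 := h.2 S0 {x | (x ∉ E ∧ x ∈ C) ∨ (x ∈ E ∧ ∃ q ∈ Q, q ∈ C)} hS0 ?_ a ha haS0
      (Or.inl ⟨(hKX a ha).2, haC⟩) b hb hbS0
    · rcases h1 with h1 | h1
      · exact h1.2
      · exact absurd h1.1 (hKX b hb).2
    · have hQC : (∃ q ∈ Q, q ∈ C) → ∀ q ∈ Q, q ∈ C := by
        rintro ⟨q, hq, hqC⟩
        exact hQ C (fun x hx y hy hxy hxC => hC x (Finset.mem_union_right _ hx) (hQS0 x hx) y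
          (Finset.mem_union_right _ hy) (hQS0 y hy) hxy hxC) q hq hqC
      rintro x hx hxS y hy hyS hxy (⟨hxE, hxC⟩ | ⟨hxE, hq⟩)
      · by_cases hyE : y ∈ E
        · obtain ⟨q, hq, hqx⟩ := hSQ (by omega) x (hES y hyE x hx hxE hxy.symm)
          exact Or.inr ⟨hyE, q, hq, hC x (by simp [hx, hxE]) hxS q (by simp [hq]) (hQS0 q hq)
            hqx.symm hxC⟩
        · exact Or.inl ⟨hyE, hCX x hx hxE hxS y hy hyE hyS hxy hxC⟩
      · by_cases hyE : y ∈ E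
        · exact Or.inr ⟨hyE, hq⟩
        · obtain ⟨q, hqQ, hqy⟩ := hSQ (by omega) y (hES x hxE y hy hyE hxy)
          exact Or.inl ⟨hyE, hC q (by simp [hqQ]) (hQS0 q hqQ) y (by simp [hy, hyE]) hyS hqy
            (hQC hq q hqQ)⟩

end

end SimpleGraph

namespace SimpleGraph

section

open scoped Classical

variable {V : Type*} {G : SimpleGraph V}

/-- A connected set attached to three vertices contains a vertex that cannot be separated from
these by two vertices. -/
lemma ConnOn.exists_tripod {D N : Finset V} (hD : G.ConnOn D) (hN : N.card = 3)
    (hDN : Disjoint D N) (hadj : ∀ k ∈ N, ∃ d ∈ D, G.Adj d k) :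
    ∃ t ∈ D, ∀ (S : Finset V) (C : Set V), S.card ≤ 2 → t ∉ S → t ∈ C →
      (∀ x ∈ D ∪ N, x ∉ S → ∀ y ∈ D ∪ N, y ∉ S → G.Adj x y → x ∈ C → y ∈ C) →
      ∃ k ∈ N, k ∉ S ∧ k ∈ C := by
  induction hn : D.card using Nat.strong_induction_on generalizing D N with
  | _ n ih =>
  have hDN' : ∀ d ∈ D, d ∉ N := fun d hd => Finset.disjoint_left.mp hDN hd
  obtain ⟨r, hr⟩ : ∃ r, r ∈ D := by
    obtain ⟨k, hk⟩ : N.Nonempty := Finset.card_pos.mp (by omega)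
    obtain ⟨d, hd, _⟩ := hadj k hk
    exact ⟨d, hd⟩
  by_cases hDr : D = {r}
  · refine ⟨r, hr, fun S C hS hrS hrC hC => ?_⟩
    obtain ⟨k, hk, hkS⟩ := Finset.exists_mem_notMem_of_card_lt_card (show S.card < N.card by omega)
    obtain ⟨d, hd, hdk⟩ := hadj k hk
    have : d = r := by simpa [hDr] using hd
    subst this
    exact ⟨k, hk, hkS, hC d (by simp [hr]) hrS k (by simp [hk]) hkS hdk hrC⟩
  obtain ⟨x, hx, hxr, hxc⟩ := hD.exists_erase hr hDr
  have hlt : (D.erase x).card < n := hn ▸ Finset.card_erase_lt_of_mem hx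
  have hsub : D.erase x ⊆ D := Finset.erase_subset _ _
  have hLx : ∀ k ∈ N, (¬ ∃ d ∈ D.erase x, G.Adj d k) → G.Adj x k := by
    intro k hk hk'
    obtain ⟨d, hd, hdk⟩ := hadj k hk
    by_cases hdx : d = x
    · exact hdx ▸ hdk
    · exact absurd ⟨d, Finset.mem_erase.mpr ⟨hdx, hd⟩, hdk⟩ hk'
  by_cases hL0 : ∀ k ∈ N, ∃ d ∈ D.erase x, G.Adj d k
  · obtain ⟨t, ht, h⟩ := ih _ hlt hxc hN (Finset.disjoint_of_subset_left hsub hDN) hL0 rfl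
    refine ⟨t, hsub ht, fun S C hS htS htC hC => h S C hS htS htC fun y hy hyS z hz =>
      hC y (Finset.union_subset_union_left hsub hy) hyS z (Finset.union_subset_union_left hsub hz)⟩
  push Not at hL0
  obtain ⟨k, hk, hkx⟩ := hL0
  have hxk : G.Adj x k := hLx k hk (by push Not; exact hkx)
  by_cases hL1 : ∀ l ∈ N, l ≠ k → ∃ d ∈ D.erase x, G.Adj d l
  · have hxN : x ∉ N.erase k := fun h => hDN' x hx (Finset.mem_erase.mp h).2
    obtain ⟨t, ht, h⟩ := ih _ hlt hxc (N := insert x (N.erase k))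
      (by rw [Finset.card_insert_of_notMem hxN, Finset.card_erase_of_mem hk, hN])
      (by
        rw [Finset.disjoint_left]
        intro d hd hd'
        rcases Finset.mem_insert.mp hd' with rfl | hd'
        · simp at hd
        · exact hDN' d (hsub hd) (Finset.mem_erase.mp hd').2)
      (by
        intro l hl
        rcases Finset.mem_insert.mp hl with rfl | hl
        · obtain ⟨l', hl', y, hy, hyl, hly⟩ := hD.exists_adj (L := {l}) (by simpa using hx)
            (by simp) (fun h => hxr (by rw [← h] at hr; exact (Finset.mem_singleton.mp hr).symm))
          rw [Finset.mem_singleton] at hl' hyl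
          subst hl'
          exact ⟨y, Finset.mem_erase.mpr ⟨hyl, hy⟩, hly.symm⟩
        · exact hL1 l (Finset.mem_erase.mp hl).2 (Finset.mem_erase.mp hl).1) rfl
    have hsub' : D.erase x ∪ insert x (N.erase k) ⊆ D ∪ N := by
      intro y hy
      simp only [Finset.mem_union, Finset.mem_insert, Finset.mem_erase] at hy ⊢
      rcases hy with hy | rfl | hy
      · exact Or.inl hy.2
      · exact Or.inl hx
      · exact Or.inr hy.2
    have hkn : ∀ y ∈ D.erase x ∪ insert x (N.erase k), y ≠ k := by
      rintro y hy rfl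
      simp only [Finset.mem_union, Finset.mem_insert, Finset.mem_erase] at hy
      rcases hy with hy | hy | hy
      · exact hDN' y hy.2 hk
      · exact hDN' x hx (hy ▸ hk)
      · exact hy.1 rfl
    refine ⟨t, hsub ht, fun S C hS htS htC hC => ?_⟩
    by_cases hkS : k ∈ S
    · obtain ⟨k', hk', hk'S, hk'C⟩ := h (insert x (S.erase k)) C
        (by
          have h1 := Finset.card_insert_le x (S.erase k)
          rw [Finset.card_erase_of_mem hkS] at h1
          have : 0 < S.card := Finset.card_pos.mpr ⟨k, hkS⟩
          omega)
        (by
          simp only [Finset.mem_insert, Finset.mem_erase, not_or, not_and]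
          exact ⟨(Finset.mem_erase.mp ht).1, fun _ => htS⟩) htC
        (fun y hy hyS z hz hzS => hC y (hsub' hy)
          (fun h => hyS (Finset.mem_insert_of_mem (Finset.mem_erase.mpr ⟨hkn y hy, h⟩)))
          z (hsub' hz)
          (fun h => hzS (Finset.mem_insert_of_mem (Finset.mem_erase.mpr ⟨hkn z hz, h⟩))))
      simp only [Finset.mem_insert, Finset.mem_erase, not_or, not_and] at hk' hk'S
      rcases hk' with rfl | hk'
      · exact absurd rfl hk'S.1
      · exact ⟨k', hk'.2, hk'S.2 hk'.1, hk'C⟩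
    · obtain ⟨k', hk', hk'S, hk'C⟩ := h S C hS htS htC
        (fun y hy hyS z hz => hC y (hsub' hy) hyS z (hsub' hz))
      simp only [Finset.mem_insert, Finset.mem_erase] at hk'
      rcases hk' with rfl | hk'
      · exact ⟨k, hk, hkS, hC k' (by simp [hx]) hk'S k (by simp [hk]) hkS hxk hk'C⟩
      · exact ⟨k', hk'.2, hk'S, hk'C⟩
  push Not at hL1
  obtain ⟨l, hl, hlk, hlx⟩ := hL1
  have hxl : G.Adj x l := hLx l hl (by push Not; exact hlx)
  refine ⟨x, hx, fun S C hS hxS hxC hC => ?_⟩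
  by_cases hkS : k ∈ S
  swap
  · exact ⟨k, hk, hkS, hC x (by simp [hx]) hxS k (by simp [hk]) hkS hxk hxC⟩
  by_cases hlS : l ∈ S
  swap
  · exact ⟨l, hl, hlS, hC x (by simp [hx]) hxS l (by simp [hl]) hlS hxl hxC⟩
  have hSeq : {k, l} = S := Finset.eq_of_subset_of_card_le
    (by simp [Finset.insert_subset_iff, hkS, hlS]) (by rw [Finset.card_pair hlk.symm]; exact hS)
  have hDS : ∀ d ∈ D, d ∉ S := by
    intro d hd hdS
    rw [← hSeq, Finset.mem_insert, Finset.mem_singleton] at hdS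
    rcases hdS with rfl | rfl
    · exact hDN' _ hd hk
    · exact hDN' _ hd hl
  obtain ⟨j, hj, hjS⟩ := Finset.exists_mem_notMem_of_card_lt_card (show S.card < N.card by omega)
  obtain ⟨d, hd, hdj⟩ := hadj j hj
  have hdC : d ∈ C := hD C (fun y hy z hz => hC y (by simp [hy]) (hDS y hy) z (by simp [hz])
    (hDS z hz)) x hx hxC d hd
  exact ⟨j, hj, hjS, hC d (by simp [hd]) (hDS d hd) j (by simp [hj]) hjS hdj hdC⟩

lemma Insep.exists_insert {K X D : Finset V} (h : G.Insep K X) (hDX : D ⊆ X)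
    (hD : G.ConnOn D) (hDK : Disjoint D K)
    (hcard : 3 ≤ (K.filter fun k => ∃ d ∈ D, G.Adj d k).card) :
    ∃ t ∈ D, G.Insep (insert t K) X := by
  obtain ⟨N, hNsub, hN⟩ := Finset.exists_subset_card_eq hcard
  have hNK : ∀ k ∈ N, k ∈ K := fun k hk => (Finset.mem_filter.mp (hNsub hk)).1
  obtain ⟨t, ht, hsep⟩ := hD.exists_tripod hN (Finset.disjoint_of_subset_right hNK hDK)
    fun k hk => (Finset.mem_filter.mp (hNsub hk)).2
  have hsub : D ∪ N ⊆ X := Finset.union_subset hDX fun k hk => h.1 (hNK k hk)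
  refine ⟨t, ht, Finset.insert_subset (hDX ht) h.1, fun S C hS hC a ha haS haC b hb hbS => ?_⟩
  rcases Finset.mem_insert.mp ha with rfl | haK
  · rcases Finset.mem_insert.mp hb with rfl | hbK
    · exact haC
    · obtain ⟨k, hk, hkS, hkC⟩ := hsep S C hS haS haC
        fun x hx hxS y hy => hC x (hsub hx) hxS y (hsub hy)
      exact h.2 S C hS hC k (hNK k hk) hkS hkC b hbK hbS
  · rcases Finset.mem_insert.mp hb with rfl | hbK
    · by_contra hbC
      obtain ⟨k, hk, hkS, hkC⟩ := hsep S Cᶜ hS hbS hbC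
        fun x hx hxS y hy hyS hxy hxC hyC => hxC (hC y (hsub hy) hyS x (hsub hx) hxS hxy.symm hyC)
      exact hkC (h.2 S C hS hC a haK haS haC k (hNK k hk) hkS)
    · exact h.2 S C hS hC a haK haS haC b hbK hbS

end

end SimpleGraph

namespace SimpleGraph

section

open scoped Classical

variable {V : Type*} (G : SimpleGraph V)

/-- The vertices of `X` outside `D` with a neighbour in `D`. -/
noncomputable def bdry (X D : Finset V) : Finset V := X.filter fun y => y ∉ D ∧ ∃ d ∈ D, G.Adj d y

variable {G}

lemma mem_bdry {X D : Finset V} {y : V} :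
    y ∈ G.bdry X D ↔ y ∈ X ∧ y ∉ D ∧ ∃ d ∈ D, G.Adj d y := by
  simp [bdry]

lemma card_bdry_inter_of_separated {X D A S₀ : Finset V}
    (hmin : ∀ E ⊆ D, E.Nonempty → E.card < D.card → 3 ≤ (G.bdry X E).card)
    (hA : ∀ x ∈ A, ∀ y ∈ X, G.Adj x y → y ∈ A ∨ y ∈ S₀) (hDA : (D ∩ A).Nonempty) {b : V}
    (hb : b ∈ D ∪ G.bdry X D) (hbA : b ∉ A) (hbS : b ∉ S₀) :
    3 ≤ (G.bdry X D ∩ A).card + (G.bdry X D ∩ S₀).card + (D ∩ S₀).card := by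
  have hne : D ∩ A ≠ D := by
    intro h
    have hDA' : ∀ d ∈ D, d ∈ A := fun d hd => (Finset.mem_inter.mp (h.symm ▸ hd)).2
    rcases Finset.mem_union.mp hb with hb | hb
    · exact hbA (hDA' b hb)
    · obtain ⟨hbX, _, d, hd, hdb⟩ := mem_bdry.mp hb
      rcases hA d (hDA' d hd) b hbX hdb with h | h
      · exact hbA h
      · exact hbS h
  have h1 := hmin (D ∩ A) Finset.inter_subset_left hDA (Finset.card_lt_card
    (Finset.ssubset_iff_subset_ne.mpr ⟨Finset.inter_subset_left, hne⟩))
  have h2 : G.bdry X (D ∩ A) ⊆ (G.bdry X D ∩ A) ∪ (G.bdry X D ∩ S₀) ∪ (D ∩ S₀) := by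
    intro y hy
    obtain ⟨hyX, hyD, d, hd, hdy⟩ := mem_bdry.mp hy
    simp only [Finset.mem_union, Finset.mem_inter, mem_bdry] at hyD hd ⊢
    have hyA := hA d hd.2 y hyX hdy
    by_cases hyD' : y ∈ D
    · exact Or.inr ⟨hyD', hyA.resolve_left fun h => hyD ⟨hyD', h⟩⟩
    · rcases hyA with h | h
      · exact Or.inl (Or.inl ⟨⟨hyX, hyD', d, hd.1, hdy⟩, h⟩)
      · exact Or.inl (Or.inr ⟨⟨hyX, hyD', d, hd.1, hdy⟩, h⟩)
  have h3 := Finset.card_le_card h2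
  have h4 := Finset.card_union_le (G.bdry X D ∩ A ∪ G.bdry X D ∩ S₀) (D ∩ S₀)
  have h5 := Finset.card_union_le (G.bdry X D ∩ A) (G.bdry X D ∩ S₀)
  omega

lemma false_of_separated_of_minimal {X D D₀ A S₀ : Finset V} (hD₀X : D₀ ⊆ X) (hDD₀ : D ⊆ D₀)
    (hD : D.Nonempty)
    (hmin₀ : ∀ E ⊆ X, E.Nonempty → E.card < D₀.card → 2 ≤ (G.bdry X E).card)
    (hmin : ∀ E ⊆ D₀, E.Nonempty → E.card < D.card → 3 ≤ (G.bdry X E).card)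
    (hS₀ : S₀.card ≤ 2) (hS₀D : S₀ ⊆ D) (hAX : A ⊆ X) (hcard : (D ∩ A).card + 2 ≤ D.card)
    (hA : ∀ x ∈ A, ∀ y ∈ X, G.Adj x y → y ∈ A ∨ y ∈ S₀) {s : V}
    (hs : G.bdry X D ∩ A = {s}) (hA₀ : ∀ y ∈ G.bdry X D₀, y ∉ A) : False := by
  have hsA : s ∈ G.bdry X D ∧ s ∈ A := Finset.mem_inter.mp (hs ▸ Finset.mem_singleton_self s)
  have hs' : ∀ y ∈ G.bdry X D, y ∈ A → y = s := fun y hy hyA =>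
    Finset.mem_singleton.mp (hs ▸ Finset.mem_inter.mpr ⟨hy, hyA⟩)
  have hE : ∀ e ∈ A, e ∉ D → e ≠ s → e ∉ D₀ := by
    intro e heA heD hes heD₀
    set E := (A.filter fun e => e ∉ D ∧ e ≠ s) ∩ D₀ with hEdef
    have hmemE : ∀ x, x ∈ E ↔ (x ∈ A ∧ x ∉ D ∧ x ≠ s) ∧ x ∈ D₀ := by
      intro x; simp [hEdef]
    have h1 := hmin₀ E (fun x hx => hD₀X ((hmemE x).mp hx).2) ⟨e, (hmemE e).mpr ⟨⟨heA, heD, hes⟩, heD₀⟩⟩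
      (Finset.card_lt_card (Finset.ssubset_iff_of_subset (fun x hx => ((hmemE x).mp hx).2) |>.mpr
        (by
          obtain ⟨d, hd⟩ := hD
          exact ⟨d, hDD₀ hd, fun h => ((hmemE d).mp h).1.2.1 hd⟩)))
    have h2 : G.bdry X E ⊆ {s} := by
      intro y hy
      obtain ⟨hyX, hyE, x, hx, hxy⟩ := mem_bdry.mp hy
      obtain ⟨⟨hxA, hxD, hxs⟩, hxD₀⟩ := (hmemE x).mp hx
      have hyD : y ∉ D := fun h => hxs (hs' x (mem_bdry.mpr ⟨hAX hxA, hxD, y, h, hxy.symm⟩) hxA)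
      have hyA : y ∈ A := (hA x hxA y hyX hxy).resolve_right fun h => hyD (hS₀D h)
      by_contra hys
      rw [Finset.mem_singleton] at hys
      have hyD₀ : y ∉ D₀ := fun h => hyE ((hmemE y).mpr ⟨⟨hyA, hyD, hys⟩, h⟩)
      exact hA₀ y (mem_bdry.mpr ⟨hyX, hyD₀, x, hxD₀, hxy⟩) hyA
    have h3 := Finset.card_le_card h2
    rw [Finset.card_singleton] at h3
    omega
  obtain ⟨hsX, hsD, d, hd, hds⟩ := mem_bdry.mp hsA.1
  have hsD₀ : s ∈ D₀ := by
    by_contra h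
    exact hA₀ s (mem_bdry.mpr ⟨hsX, h, d, hDD₀ hd, hds⟩) hsA.2
  have h1 := hmin (insert s (D ∩ A))
    (Finset.insert_subset hsD₀ (Finset.inter_subset_left.trans hDD₀)) (Finset.insert_nonempty _ _)
    (by have := Finset.card_insert_le s (D ∩ A); omega)
  have h2 : G.bdry X (insert s (D ∩ A)) ⊆ S₀ := by
    intro y hy
    obtain ⟨hyX, hyD, x, hx, hxy⟩ := mem_bdry.mp hy
    simp only [Finset.mem_insert, Finset.mem_inter, not_or, not_and] at hyD hx
    by_contra hyS
    have hxA : x ∈ A := by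
      rcases hx with rfl | hx
      · exact hsA.2
      · exact hx.2
    have hyA := (hA x hxA y hyX hxy).resolve_right hyS
    have hyD' : y ∉ D := fun h => hyD.2 h hyA
    rcases hx with rfl | hx
    · exact hA₀ y (mem_bdry.mpr ⟨hyX, hE y hyA hyD' hyD.1, x, hsD₀, hxy⟩) hyA
    · exact hyD.1 (hs' y (mem_bdry.mpr ⟨hyX, hyD', x, hx.1, hxy⟩) hyA)
  have h3 := Finset.card_le_card h2
  omega

/-- A graph of minimum degree at least three contains four vertices no two of which are separated
by two vertices. -/
lemma exists_insep_of_three_le_degree {X : Finset V} (hX : X.Nonempty)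
    (hdeg : ∀ x ∈ X, 3 ≤ (X.filter (G.Adj x)).card) : ∃ K, 4 ≤ K.card ∧ G.Insep K X := by
  obtain ⟨D₀, hD₀, hmin₀⟩ := Finset.exists_min_image
    (X.powerset.filter fun D => D.Nonempty ∧ (G.bdry X D).card ≤ 1) Finset.card
    ⟨X, by
      have : G.bdry X X = ∅ := by
        ext y; simp only [mem_bdry, Finset.notMem_empty, iff_false]; tauto
      simp [hX, this]⟩
  simp only [Finset.mem_filter, Finset.mem_powerset, and_imp] at hD₀ hmin₀
  obtain ⟨hD₀X, hD₀ne, hD₀c⟩ := hD₀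
  obtain ⟨D, hD, hmin⟩ := Finset.exists_min_image
    (D₀.powerset.filter fun D => D.Nonempty ∧ (G.bdry X D).card ≤ 2) Finset.card
    ⟨D₀, by
      simp only [Finset.mem_filter, Finset.mem_powerset]
      exact ⟨Finset.Subset.refl _, hD₀ne, by omega⟩⟩
  simp only [Finset.mem_filter, Finset.mem_powerset, and_imp] at hD hmin
  obtain ⟨hDD₀, hDne, hDc⟩ := hD
  have hDX := hDD₀.trans hD₀X
  have hmin₀' : ∀ E ⊆ X, E.Nonempty → E.card < D₀.card → 2 ≤ (G.bdry X E).card := by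
    intro E hE hne hlt
    by_contra hcon
    have := hmin₀ E hE hne (by omega)
    omega
  have hmin' : ∀ E ⊆ D₀, E.Nonempty → E.card < D.card → 3 ≤ (G.bdry X E).card := by
    intro E hE hne hlt
    by_contra hcon
    have := hmin E hE hne (by omega)
    omega
  have hdisj : Disjoint D (G.bdry X D) :=
    Finset.disjoint_left.mpr fun d hd hd' => (mem_bdry.mp hd').2.1 hd
  have hdegD : ∀ x ∈ D, 4 ≤ D.card + (G.bdry X D).card := by
    intro x hx
    have h1 : X.filter (G.Adj x) ⊆ (D ∪ G.bdry X D).erase x := by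
      intro y hy
      obtain ⟨hyX, hxy⟩ := Finset.mem_filter.mp hy
      refine Finset.mem_erase.mpr ⟨hxy.ne', Finset.mem_union.mpr ?_⟩
      by_cases hyD : y ∈ D
      · exact Or.inl hyD
      · exact Or.inr (mem_bdry.mpr ⟨hyX, hyD, x, hx, hxy⟩)
    have h2 := Finset.card_le_card h1
    rw [Finset.card_erase_of_mem (Finset.mem_union_left _ hx),
      Finset.card_union_of_disjoint hdisj] at h2
    have := hdeg x (hDX hx)
    omega
  obtain ⟨d₀, hd₀⟩ := hDne
  have hfour := hdegD d₀ hd₀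
  refine ⟨D ∪ G.bdry X D, by rwa [Finset.card_union_of_disjoint hdisj],
    Finset.union_subset hDX (Finset.filter_subset _ _), fun S₀ C hS₀ hC a ha haS haC b hb hbS => ?_⟩
  by_contra hbC
  set A := X.filter fun x => x ∉ S₀ ∧ x ∈ C with hAdef
  set B := X.filter fun x => x ∉ S₀ ∧ x ∉ C with hBdef
  have hKX : ∀ x ∈ D ∪ G.bdry X D, x ∈ X := fun x hx =>
    Finset.union_subset hDX (Finset.filter_subset _ _) hx
  have haA : a ∈ A := by simp [hAdef, hKX a ha, haS, haC]
  have hbB : b ∈ B := by simp [hBdef, hKX b hb, hbS, hbC]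
  have hAB : ∀ x ∈ A, x ∉ B := by
    intro x hx hx'
    simp only [hAdef, hBdef, Finset.mem_filter] at hx hx'
    exact hx'.2.2 hx.2.2
  have hAS : ∀ x ∈ A, x ∉ S₀ := fun x hx => (Finset.mem_filter.mp hx).2.1
  have hBS : ∀ x ∈ B, x ∉ S₀ := fun x hx => (Finset.mem_filter.mp hx).2.1
  have hA : ∀ x ∈ A, ∀ y ∈ X, G.Adj x y → y ∈ A ∨ y ∈ S₀ := by
    intro x hx y hy hxy
    simp only [hAdef, Finset.mem_filter] at hx ⊢
    by_cases hyS : y ∈ S₀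
    · exact Or.inr hyS
    · exact Or.inl ⟨hy, hyS, hC x hx.1 hx.2.1 y hy hyS hxy hx.2.2⟩
  have hB : ∀ x ∈ B, ∀ y ∈ X, G.Adj x y → y ∈ B ∨ y ∈ S₀ := by
    intro x hx y hy hxy
    simp only [hBdef, Finset.mem_filter] at hx ⊢
    by_cases hyS : y ∈ S₀
    · exact Or.inr hyS
    · exact Or.inl ⟨hy, hyS, fun h => hx.2.2 (hC y hy hyS x hx.1 hx.2.1 hxy.symm h)⟩
  have hsplit : ∀ Y ⊆ X, Y.card = (Y ∩ A).card + (Y ∩ B).card + (Y ∩ S₀).card := by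
    intro Y hY
    rw [← Finset.card_union_of_disjoint, ← Finset.card_union_of_disjoint]
    · congr 1
      ext y
      simp only [Finset.mem_union, Finset.mem_inter, hAdef, hBdef, Finset.mem_filter]
      constructor
      · intro hy
        have := hY hy
        by_cases h1 : y ∈ S₀ <;> by_cases h2 : y ∈ C <;> simp [h1, h2, hy, this]
      · rintro ((h | h) | h) <;> exact h.1
    · refine Finset.disjoint_left.mpr fun y hy hy' => ?_
      simp only [Finset.mem_union, Finset.mem_inter] at hy hy'
      rcases hy with hy | hy
      · exact hAS y hy.2 hy'.2
      · exact hBS y hy.2 hy'.2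
    · refine Finset.disjoint_left.mpr fun y hy hy' => ?_
      simp only [Finset.mem_inter] at hy hy'
      exact hAB y hy.2 hy'.2
  have hSX : G.bdry X D ⊆ X := Finset.filter_subset _ _
  have hD1 := hsplit D hDX
  have hS1 := hsplit _ hSX
  have hS2 : (G.bdry X D ∩ S₀).card + (D ∩ S₀).card ≤ S₀.card := by
    rw [← Finset.card_union_of_disjoint]
    · exact Finset.card_le_card (Finset.union_subset Finset.inter_subset_right
        Finset.inter_subset_right)
    · exact Finset.disjoint_of_subset_left Finset.inter_subset_left
        (Finset.disjoint_of_subset_right Finset.inter_subset_left hdisj.symm)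
  have hpos : ∀ {A : Finset V} {a : V}, a ∈ D ∪ G.bdry X D → a ∈ A → (D ∩ A).card = 0 →
      1 ≤ (G.bdry X D ∩ A).card := by
    intro A a ha haA h
    rw [Finset.card_eq_zero] at h
    refine Finset.card_pos.mpr ⟨a, Finset.mem_inter.mpr
      ⟨(Finset.mem_union.mp ha).resolve_left fun h' => ?_, haA⟩⟩
    exact Finset.notMem_empty a (h ▸ Finset.mem_inter.mpr ⟨h', haA⟩)
  have hA1 := hpos ha haA
  have hB1 := hpos hb hbB
  have hA2 : (D ∩ A).card ≠ 0 → _ := fun h => card_bdry_inter_of_separated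
    (fun E hE => hmin' E (hE.trans hDD₀)) hA (Finset.card_pos.mp (Nat.pos_of_ne_zero h)) hb
    (fun h => hAB b h hbB) hbS
  have hB2 : (D ∩ B).card ≠ 0 → _ := fun h => card_bdry_inter_of_separated
    (fun E hE => hmin' E (hE.trans hDD₀)) hB (Finset.card_pos.mp (Nat.pos_of_ne_zero h)) ha
    (hAB a haA) haS
  have hDS : (D ∩ S₀).card = 2 ∧ (G.bdry X D ∩ A).card = 1 ∧ (G.bdry X D ∩ B).card = 1 := by
    by_cases h1 : (D ∩ A).card = 0 <;> by_cases h2 : (D ∩ B).card = 0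
    · have := hA1 h1; have := hB1 h2; omega
    · have := hA1 h1; have := hB2 h2; omega
    · have := hA2 h1; have := hB1 h2; omega
    · have := hA2 h1; have := hB2 h2; omega
  have hS₀D : S₀ ⊆ D := by
    have : D ∩ S₀ = S₀ := Finset.eq_of_subset_of_card_le Finset.inter_subset_right (by omega)
    rw [← this]
    exact Finset.inter_subset_left
  obtain ⟨s, hs⟩ := Finset.card_eq_one.mp hDS.2.1
  obtain ⟨s', hs'⟩ := Finset.card_eq_one.mp hDS.2.2
  by_cases h0 : ∀ y ∈ G.bdry X D₀, y ∉ A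
  · exact false_of_separated_of_minimal (A := A) hD₀X hDD₀ ⟨d₀, hd₀⟩ hmin₀' hmin' hS₀ hS₀D
      (Finset.filter_subset _ _) (by omega) hA hs h0
  · push Not at h0
    obtain ⟨y, hy, hyA⟩ := h0
    refine false_of_separated_of_minimal (A := B) hD₀X hDD₀ ⟨d₀, hd₀⟩ hmin₀' hmin' hS₀ hS₀D
      (Finset.filter_subset _ _) (by omega) hB hs' fun z hz => ?_
    rw [Finset.card_le_one.mp hD₀c z hz y hy]
    exact hAB y hyA

end

end SimpleGraph

namespace SimpleGraph

section

open scoped Classical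

variable {V : Type*} {G : SimpleGraph V}

lemma Insep.exists_separated {K X : Finset V} (h : G.Insep K X) {a : V} (ha : a ∈ X)
    (hn : ¬ G.Insep (insert a K) X) :
    ∃ S E : Finset V, S.card ≤ 2 ∧ a ∈ E ∧ E ⊆ X ∧ G.ConnOn E ∧ Disjoint K E ∧
      ∀ e ∈ E, ∀ y ∈ X, y ∉ E → G.Adj e y → y ∈ S := by
  obtain ⟨S, C, hS, hC, haS, haC, b, hb, hbS, hbC⟩ : ∃ (S : Finset V) (C : Set V), S.card ≤ 2 ∧
      (∀ x ∈ X, x ∉ S → ∀ y ∈ X, y ∉ S → G.Adj x y → x ∈ C → y ∈ C) ∧ a ∉ S ∧ a ∈ C ∧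
      ∃ b ∈ K, b ∉ S ∧ b ∉ C := by
    by_contra! hcon
    refine hn ⟨Finset.insert_subset ha h.1, fun S C hS hC x hx hxS hxC y hy hyS => ?_⟩
    rcases Finset.mem_insert.mp hx with rfl | hxK
    · rcases Finset.mem_insert.mp hy with rfl | hyK
      · exact hxC
      · exact hcon S C hS hC hxS hxC y hyK hyS
    · rcases Finset.mem_insert.mp hy with rfl | hyK
      · by_contra hyC
        exact hcon S Cᶜ hS (fun u hu huS v hv hvS huv huC hvC =>
          huC (hC v hv hvS u hu huS huv.symm hvC)) hyS hyC x hxK hxS hxC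
      · exact h.2 S C hS hC x hxK hxS hxC y hyK hyS
  obtain ⟨E, hE, haE, hEc, hEm⟩ := exists_component (G := G) (Finset.mem_sdiff.mpr ⟨ha, haS⟩)
  have hEX : ∀ e ∈ E, e ∈ X ∧ e ∉ S := fun e he => Finset.mem_sdiff.mp (hE he)
  refine ⟨S, E, hS, haE, fun e he => (hEX e he).1, hEc, Finset.disjoint_left.mpr fun k hk hkE => ?_,
    fun e he y hy hyE hey => ?_⟩
  · have hkC : k ∈ C := hEc C (fun x hx y hy => hC x (hEX x hx).1 (hEX x hx).2 y (hEX y hy).1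
      (hEX y hy).2) a haE haC k hkE
    exact hbC (h.2 S C hS hC k hk (hEX k hkE).2 hkC b hb hbS)
  · by_contra hyS
    exact hyE (hEm e he y (Finset.mem_sdiff.mpr ⟨hy, hyS⟩) hey)

lemma Insep.exists_trim {K X E S : Finset V} (h : G.Insep K X) (hK : 4 ≤ K.card) (hEX : E ⊆ X)
    (hKE : Disjoint K E) (hE : G.ConnOn E) {z : V} (hz : z ∈ E) (hS : S.card ≤ 2)
    (hES : ∀ e ∈ E, ∀ y ∈ X, y ∉ E → G.Adj e y → y ∈ S) :
    ∃ F ⊆ E, G.Insep K (X \ F) ∧ (X.filter (G.Adj z)).card ≤ F.card + 2 := by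
  obtain ⟨P, hPE, hzP, hP, hSP, hcard⟩ := hE.exists_fan hz G.Adj
    (S.filter fun s => ∃ e ∈ E, G.Adj e s) fun s hs => (Finset.mem_filter.mp hs).2
  have hS' : (S.filter fun s => ∃ e ∈ E, G.Adj e s).card ≤ 2 := (Finset.card_filter_le _ _).trans hS
  refine ⟨E \ P, Finset.sdiff_subset, ?_, ?_⟩
  · have h1 := h.replace hK hKE hS' (fun e he y hy hyE hey =>
      Finset.mem_filter.mpr ⟨hES e he y hy hyE hey, e, he, hey⟩) hP (fun q hq _ => hPE hq)
      fun _ => hSP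
    convert h1 using 1
    ext x
    simp only [Finset.mem_sdiff, Finset.mem_union, not_and, not_not]
    constructor
    · rintro ⟨hx, hxP⟩
      by_cases hxE : x ∈ E
      · exact Or.inr (hxP hxE)
      · exact Or.inl ⟨hx, hxE⟩
    · rintro (⟨hx, hxE⟩ | hx)
      · exact ⟨hx, fun h => absurd h hxE⟩
      · exact ⟨hEX (hPE hx), fun _ => hx⟩
  · have h1 : X.filter (G.Adj z) ⊆ (E \ P) ∪ (P.filter (G.Adj z) ∪
        (S.filter fun s => ∃ e ∈ E, G.Adj e s).filter (G.Adj z)) := by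
      intro y hy
      obtain ⟨hyX, hzy⟩ := Finset.mem_filter.mp hy
      simp only [Finset.mem_union, Finset.mem_sdiff, Finset.mem_filter]
      by_cases hyE : y ∈ E
      · by_cases hyP : y ∈ P
        · exact Or.inr (Or.inl ⟨hyP, hzy⟩)
        · exact Or.inl ⟨hyE, hyP⟩
      · exact Or.inr (Or.inr ⟨⟨hES z hz y hyX hyE hzy, z, hz, hzy⟩, hzy⟩)
    have h2 := Finset.card_le_card h1
    have h3 := Finset.card_union_le (E \ P) (P.filter (G.Adj z) ∪
        (S.filter fun s => ∃ e ∈ E, G.Adj e s).filter (G.Adj z))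
    have h4 := Finset.card_union_le (P.filter (G.Adj z))
        ((S.filter fun s => ∃ e ∈ E, G.Adj e s).filter (G.Adj z))
    omega

lemma card_filter_adj_add_compl [Fintype V] (X : Finset V) (z : V) :
    (X.filter (G.Adj z)).card + (Xᶜ.filter (G.Adj z)).card =
      (Finset.univ.filter (G.Adj z)).card := by
  rw [← Finset.card_union_of_disjoint (Finset.disjoint_filter_filter disjoint_compl_right),
    ← Finset.filter_union, Finset.union_compl]

end

end SimpleGraph

namespace ParentTree

section

open scoped Classical

variable {W V : Type*} {T : ParentTree W} {G : SimpleGraph V}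

lemma HasCopy.mono {Z Z' : Finset V} (h : T.HasCopy G Z) (hZ : Z ⊆ Z') : T.HasCopy G Z' := by
  obtain ⟨φ, h1, h2, h3⟩ := h
  exact ⟨φ, h1, h2, fun w => hZ (h3 w)⟩

lemma HasCopy.exists_card_eq [Fintype W] {Z : Finset V} (h : T.HasCopy G Z) :
    ∃ Z' ⊆ Z, T.HasCopy G Z' ∧ Z'.card = Fintype.card W := by
  obtain ⟨φ, h1, h2, h3⟩ := h
  refine ⟨Finset.univ.image φ, fun x hx => ?_, ⟨φ, h1, h2, fun w => by simp⟩, ?_⟩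
  · obtain ⟨w, _, rfl⟩ := Finset.mem_image.mp hx
    exact h3 w
  · rw [Finset.card_image_of_injective _ h1, Finset.card_univ]

lemma HasCopy.card_le [Fintype W] {Z : Finset V} (h : T.HasCopy G Z) : Fintype.card W ≤ Z.card := by
  obtain ⟨Z', h1, _, h2⟩ := h.exists_card_eq
  exact h2 ▸ Finset.card_le_card h1

end

end ParentTree

namespace ParentTree

section

open scoped Classical

variable {W V : Type*} [Fintype V] {T : ParentTree W} {G : SimpleGraph V}

lemma card_filter_attached_le_two {K X D : Finset V}
    (hmax : ∀ K' X', G.Insep K' X' → T.HasCopy G X'ᶜ → K'.card ≤ K.card)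
    (h : G.Insep K X) (hT : T.HasCopy G Xᶜ) (hDX : D ⊆ X) (hD : G.ConnOn D) (hDK : Disjoint D K) :
    (K.filter fun k => ∃ d ∈ D, G.Adj d k).card ≤ 2 := by
  by_contra hcon
  obtain ⟨t, ht, h'⟩ := h.exists_insert hDX hD hDK (by omega)
  have h1 := hmax _ _ h' hT
  rw [Finset.card_insert_of_notMem (Finset.disjoint_left.mp hDK ht)] at h1
  omega

/-- An inseparable set `K` of maximum size and a connected set `D` such that `K ∪ D` is the
complement of a copy of `T`. -/
lemma exists_insep_union_connOn [Fintype W]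
    (hdeg : ∀ v, Fintype.card W + 3 ≤ (Finset.univ.filter (G.Adj v)).card)
    (hG : G.Insep Finset.univ Finset.univ)
    (h₀ : ∃ K X, 4 ≤ K.card ∧ G.Insep K X ∧ T.HasCopy G Xᶜ) :
    ∃ K D, 4 ≤ K.card ∧ Disjoint K D ∧ G.ConnOn D ∧ G.Insep K (K ∪ D) ∧ T.HasCopy G (K ∪ D)ᶜ ∧
      (K ∪ D)ᶜ.card = Fintype.card W ∧
      ∀ K' X', G.Insep K' X' → T.HasCopy G X'ᶜ → K'.card ≤ K.card := by
  obtain ⟨K₀, X₀, h₀1, h₀2, h₀3⟩ := h₀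
  obtain ⟨⟨K₁, X₁⟩, h₁, hmax⟩ := Finset.exists_max_image
    (Finset.univ.filter fun p : Finset V × Finset V => G.Insep p.1 p.2 ∧ T.HasCopy G p.2ᶜ)
    (fun p => p.1.card) ⟨(K₀, X₀), by simp [h₀2, h₀3]⟩
  simp only [Finset.mem_filter, Finset.mem_univ, true_and, and_imp, Prod.forall] at h₁ hmax
  have hK₁ : 4 ≤ K₁.card := h₀1.trans (hmax _ _ h₀2 h₀3)
  obtain ⟨⟨K₂, X₂, D₂⟩, h₂, hmaxD⟩ := Finset.exists_max_image
    (Finset.univ.filter fun p : Finset V × Finset V × Finset V =>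
      G.Insep p.1 p.2.1 ∧ T.HasCopy G p.2.1ᶜ ∧ K₁.card ≤ p.1.card ∧ p.2.2 ⊆ p.2.1 ∧
        Disjoint p.1 p.2.2 ∧ G.ConnOn p.2.2)
    (fun p => p.2.2.card) ⟨(K₁, X₁, ∅), by
      rw [Finset.mem_filter]
      exact ⟨Finset.mem_univ _, h₁.1, h₁.2, le_rfl, Finset.empty_subset _,
        Finset.disjoint_empty_right _, fun _ _ a ha => absurd ha (Finset.notMem_empty a)⟩⟩
  simp only [Finset.mem_filter, Finset.mem_univ, true_and, and_imp, Prod.forall] at h₂ hmaxD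
  obtain ⟨⟨K, X, D⟩, h₃, hmin⟩ := Finset.exists_min_image
    (Finset.univ.filter fun p : Finset V × Finset V × Finset V =>
      G.Insep p.1 p.2.1 ∧ T.HasCopy G p.2.1ᶜ ∧ K₁.card ≤ p.1.card ∧ p.2.2 ⊆ p.2.1 ∧
        Disjoint p.1 p.2.2 ∧ G.ConnOn p.2.2 ∧ D₂.card ≤ p.2.2.card)
    (fun p => p.2.1.card) ⟨(K₂, X₂, D₂), by simp [h₂]⟩
  simp only [Finset.mem_filter, Finset.mem_univ, true_and, and_imp, Prod.forall] at h₃ hmin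
  obtain ⟨hKX, hT, hK, hDX, hKD, hD, hDc⟩ := h₃
  have hK4 : 4 ≤ K.card := hK₁.trans hK
  have hmaxK : ∀ K' X', G.Insep K' X' → T.HasCopy G X'ᶜ → K'.card ≤ K.card :=
    fun K' X' h h' => (hmax K' X' h h').trans hK
  have hmaxD' : ∀ X' D', G.Insep K X' → T.HasCopy G X'ᶜ → D' ⊆ X' → Disjoint K D' →
      G.ConnOn D' → D'.card ≤ D.card :=
    fun X' D' h1 h2 h3 h4 h5 => (hmaxD K X' D' h1 h2 hK h3 h4 h5).trans hDc
  have hmin' : ∀ X', G.Insep K X' → T.HasCopy G X'ᶜ → D ⊆ X' → X.card ≤ X'.card :=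
    fun X' h1 h2 h3 => hmin K X' D h1 h2 hK h3 hKD hD hDc
  -- a connected set meeting or touching `D` lies in `D`
  have habs : ∀ X' E, G.Insep K X' → T.HasCopy G X'ᶜ → D ⊆ X' → E ⊆ X' → Disjoint K E →
      G.ConnOn E → ((∃ e ∈ E, e ∈ D) ∨ (∃ d ∈ D, ∃ e ∈ E, G.Adj d e)) → E ⊆ D := by
    intro X' E h1 h2 h3 h4 h5 h6 h7 e he
    have hc : G.ConnOn (D ∪ E) := by
      rcases h7 with ⟨x, hx, hx'⟩ | ⟨x, hx, y, hy, hxy⟩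
      · exact hD.union h6 hx' hx
      · exact hD.union_of_adj h6 hx hy hxy
    have := hmaxD' X' (D ∪ E) h1 h2 (Finset.union_subset h3 h4)
      (Finset.disjoint_union_right.mpr ⟨hKD, h5⟩) hc
    rw [Finset.eq_of_subset_of_card_le Finset.subset_union_left this]
    exact Finset.mem_union_right _ he
  rcases D.eq_empty_or_nonempty with rfl | ⟨d₀, hd₀⟩
  · obtain ⟨Z, hZ, hTZ, hZc⟩ := hT.exists_card_eq
    have h1 : G.Insep K Zᶜ := hKX.mono (by rwa [Finset.subset_compl_comm])
    have h2 : K = Zᶜ := by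
      refine Finset.Subset.antisymm h1.1 fun x hx => ?_
      by_contra hxK
      have := hmaxD' Zᶜ {x} h1 (by rwa [compl_compl]) (by simpa using hx) (by simpa using hxK)
        (SimpleGraph.connOn_singleton x)
      simp at this
    refine ⟨K, ∅, hK4, hKD, hD, ?_, ?_, ?_, hmaxK⟩ <;> rw [Finset.union_empty]
    · exact h2 ▸ h1
    · rwa [h2, compl_compl]
    · rw [h2, compl_compl, hZc]
  have hTm := hT.card_le
  by_cases hXm : Fintype.card W < Xᶜ.card
  · exfalso
    set A := Xᶜ.filter fun z => (∃ d ∈ D, G.Adj d z) ∨ 4 ≤ (X.filter (G.Adj z)).card with hA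
    have hAne : A.Nonempty := by
      rw [Finset.nonempty_iff_ne_empty]
      intro hAe
      have hU := card_filter_attached_le_two hmaxK hKX hT hDX hD hKD.symm
      obtain ⟨k, hk, hkU⟩ := Finset.exists_mem_notMem_of_card_lt_card
        (show (K.filter fun k => ∃ d ∈ D, G.Adj d k).card < K.card by omega)
      refine Finset.disjoint_left.mp hKD hk (hG.2 _ (D : Set V) hU
        (fun x _ _ y _ hyU hxy hxD => ?_) d₀ (Finset.mem_univ _)
        (fun h => Finset.disjoint_left.mp hKD (Finset.mem_filter.mp h).1 hd₀) hd₀ k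
        (Finset.mem_univ _) hkU)
      by_cases hyX : y ∈ X
      · have hyK : y ∉ K := fun h => hyU (Finset.mem_filter.mpr ⟨h, x, hxD, hxy⟩)
        exact habs X {y} hKX hT hDX (by simpa using hyX) (by simpa using hyK)
          (SimpleGraph.connOn_singleton y) (Or.inr ⟨x, hxD, y, by simp, hxy⟩) (by simp)
      · have : y ∈ A := Finset.mem_filter.mpr
          ⟨Finset.mem_compl.mpr hyX, Or.inl ⟨x, hxD, hxy⟩⟩
        simp [hAe] at this
    obtain ⟨a, haA, hTa⟩ := exists_hasCopy_erase hAne hT hXm (by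
      intro z hz hzA
      have h1 := G.card_filter_adj_add_compl X z
      have h2 := hdeg z
      have h3 : ¬ 4 ≤ (X.filter (G.Adj z)).card := fun h =>
        hzA (Finset.mem_filter.mpr ⟨hz, Or.inr h⟩)
      omega)
    obtain ⟨haX, ha⟩ := Finset.mem_filter.mp haA
    rw [Finset.mem_compl] at haX
    rw [← Finset.compl_insert] at hTa
    have hXa : X ⊆ insert a X := Finset.subset_insert _ _
    have hKXa := hKX.mono hXa
    obtain ⟨S, E, hS, haE, hEX, hE, hKE, hES⟩ := hKXa.exists_separated (Finset.mem_insert_self a X)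
      fun h => by
        have h1 := hmaxK _ _ h hTa
        rw [Finset.card_insert_of_notMem fun h => haX (hKX.1 h)] at h1
        omega
    have hnot : ¬ ((∃ e ∈ E, e ∈ D) ∨ (∃ d ∈ D, ∃ e ∈ E, G.Adj d e)) := fun h =>
      haX (hDX (habs _ E hKXa hTa (hDX.trans hXa) hEX hKE hE h haE))
    push Not at hnot
    have ha4 : 4 ≤ (X.filter (G.Adj a)).card := by
      rcases ha with ⟨d, hd, hda⟩ | ha
      · exact absurd hda (hnot.2 d hd a haE)
      · exact ha
    obtain ⟨F, hFE, hF, hFc⟩ := hKXa.exists_trim hK4 hEX hKE hE haE hS hES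
    have h1 : (X.filter (G.Adj a)).card ≤ ((insert a X).filter (G.Adj a)).card :=
      Finset.card_le_card (Finset.filter_subset_filter _ hXa)
    have h2 := hmin' _ hF (hTa.mono (Finset.compl_subset_compl.mpr Finset.sdiff_subset))
      fun d hd => Finset.mem_sdiff.mpr ⟨hXa (hDX hd), fun h => hnot.1 d (hFE h) hd⟩
    rw [Finset.card_sdiff_of_subset (hFE.trans hEX), Finset.card_insert_of_notMem haX] at h2
    have h3 := Finset.card_le_card (hFE.trans hEX)
    rw [Finset.card_insert_of_notMem haX] at h3
    omega
  · have hXc : Xᶜ.card = Fintype.card W := by omega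
    have hXeq : X = K ∪ D := by
      refine Finset.Subset.antisymm (fun x hx => ?_) (Finset.union_subset hKX.1 hDX)
      by_contra hxKD
      rw [Finset.mem_union, not_or] at hxKD
      obtain ⟨E, hE, hxE, hEc, hEm⟩ := SimpleGraph.exists_component (G := G)
        (Finset.mem_sdiff.mpr ⟨hx, hxKD.1⟩)
      have hEX : E ⊆ X := hE.trans Finset.sdiff_subset
      have hKE : Disjoint K E := Finset.disjoint_left.mpr fun k hk hkE =>
        (Finset.mem_sdiff.mp (hE hkE)).2 hk
      have hnot : ¬ ((∃ e ∈ E, e ∈ D) ∨ (∃ d ∈ D, ∃ e ∈ E, G.Adj d e)) := fun h =>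
        hxKD.2 (habs _ E hKX hT hDX hEX hKE hEc h hxE)
      push Not at hnot
      obtain ⟨F, hFE, hF, hFc⟩ := hKX.exists_trim hK4 hEX hKE hEc hxE
        (card_filter_attached_le_two hmaxK hKX hT hEX hEc hKE.symm)
        (fun e he y hy hyE hey => Finset.mem_filter.mpr ⟨by
          by_contra hyK
          exact hyE (hEm e he y (Finset.mem_sdiff.mpr ⟨hy, hyK⟩) hey), e, he, hey⟩)
      have h2 := hmin' _ hF (hT.mono (Finset.compl_subset_compl.mpr Finset.sdiff_subset))
        fun d hd => Finset.mem_sdiff.mpr ⟨hDX hd, fun h => hnot.1 d (hFE h) hd⟩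
      rw [Finset.card_sdiff_of_subset (hFE.trans hEX)] at h2
      have h3 := Finset.card_le_card (hFE.trans hEX)
      have h4 := G.card_filter_adj_add_compl X x
      have h5 := hdeg x
      have h6 := Finset.card_filter_le Xᶜ (G.Adj x)
      have h7 : 0 < X.card := Finset.card_pos.mpr ⟨x, hx⟩
      omega
    subst hXeq
    exact ⟨K, D, hK4, hKD, hD, hKX, hT, hXc, hmaxK⟩

end

end ParentTree

namespace SimpleGraph

section

open scoped Classical

variable {V : Type*} {G : SimpleGraph V}

lemma ConnOn.exists_fan_card {R : Finset V} (h : G.ConnOn R) {z : V} (hz : z ∈ R)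
    (att : V → V → Prop) (S : Finset V) (hS : ∀ s ∈ S, ∃ r ∈ R, att r s) :
    ∃ P ⊆ R, z ∈ P ∧ G.ConnOn P ∧ (∀ s ∈ S, ∃ p ∈ P, att p s) ∧
      (R.filter (G.Adj z)).card + (S.filter (att z)).card + P.card ≤ R.card + S.card := by
  obtain ⟨P, hPR, hzP, hP, hPS, hc⟩ := h.exists_fan hz att S hS
  refine ⟨P, hPR, hzP, hP, hPS, ?_⟩
  have h1 : R.filter (G.Adj z) ⊆ (R \ P) ∪ P.filter (G.Adj z) := by
    intro y hy
    obtain ⟨hyR, hzy⟩ := Finset.mem_filter.mp hy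
    by_cases hyP : y ∈ P
    · exact Finset.mem_union_right _ (Finset.mem_filter.mpr ⟨hyP, hzy⟩)
    · exact Finset.mem_union_left _ (Finset.mem_sdiff.mpr ⟨hyR, hyP⟩)
  have h2 := (Finset.card_le_card h1).trans (Finset.card_union_le _ _)
  have h3 := Finset.card_sdiff_add_card_eq_card hPR
  omega

variable (G) in
/-- `r` is adjacent to `k`, or `k` lies in `U` and `r` is adjacent to `Q`. -/
def LinkAdj (U Q : Finset V) (r k : V) : Prop := G.Adj r k ∨ (k ∈ U ∧ ∃ q ∈ Q, G.Adj r q)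

variable (G) in
/-- A connected set outside `K` attached to all vertices of `U`. -/
structure IsLink (K U Q : Finset V) : Prop where
  disj : Disjoint K Q
  conn : G.ConnOn Q
  att : ∀ u ∈ U, ∃ q ∈ Q, G.Adj q u

end

end SimpleGraph

namespace ParentTree

section

open scoped Classical

variable {W V : Type*} [Fintype V] (T : ParentTree W) (G : SimpleGraph V)

/-- `K` is a largest inseparable set and becomes inseparable in `K ∪ Q` for every link `Q`. -/
structure IsLinkable (K U : Finset V) : Prop where
  four_le : 4 ≤ K.card
  sub : U ⊆ K
  card : U = ∅ ∨ U.card = 2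
  max : ∀ K' X', G.Insep K' X' → T.HasCopy G X'ᶜ → K'.card ≤ K.card
  insep : ∀ Q, G.IsLink K U Q → G.Insep K (K ∪ Q)

/-- A smallest link whose removal together with `K` leaves a copy of `T`. -/
structure IsMinLink (K U Q : Finset V) : Prop where
  link : G.IsLink K U Q
  copy : T.HasCopy G (K ∪ Q)ᶜ
  min : ∀ Q', G.IsLink K U Q' → T.HasCopy G (K ∪ Q')ᶜ → Q.card ≤ Q'.card

variable {T G}

lemma exists_isLinkable {K D : Finset V} (hK : 4 ≤ K.card) (hKD : Disjoint K D) (hD : G.ConnOn D)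
    (h : G.Insep K (K ∪ D)) (hT : T.HasCopy G (K ∪ D)ᶜ)
    (hmax : ∀ K' X', G.Insep K' X' → T.HasCopy G X'ᶜ → K'.card ≤ K.card) :
    ∃ U Q, T.IsLinkable G K U ∧ T.IsMinLink G K U Q := by
  obtain ⟨U, hU, Q, hQ, hQT⟩ : ∃ U, T.IsLinkable G K U ∧
      ∃ Q, G.IsLink K U Q ∧ T.HasCopy G (K ∪ Q)ᶜ := by
    by_cases hKK : G.Insep K K
    · refine ⟨∅, ⟨hK, Finset.empty_subset _, Or.inl rfl, hmax, fun Q _ =>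
        hKK.mono Finset.subset_union_left⟩, ∅, ⟨Finset.disjoint_empty_right _,
        fun _ _ a ha => absurd ha (Finset.notMem_empty a),
        fun u hu => absurd hu (Finset.notMem_empty u)⟩, hT.mono ?_⟩
      rw [Finset.union_empty]
      exact Finset.compl_subset_compl.mpr Finset.subset_union_left
    · have hU2 := card_filter_attached_le_two hmax h hT Finset.subset_union_right hD hKD.symm
      have hES : ∀ e ∈ D, ∀ y ∈ K ∪ D, y ∉ D → G.Adj e y →
          y ∈ K.filter fun k => ∃ d ∈ D, G.Adj d k := fun e he y hy hyD hey =>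
        Finset.mem_filter.mpr ⟨(Finset.mem_union.mp hy).resolve_right hyD, e, he, hey⟩
      have hsd : (K ∪ D) \ D = K := by
        rw [Finset.union_sdiff_right, Finset.sdiff_eq_self_of_disjoint hKD]
      refine ⟨K.filter fun k => ∃ d ∈ D, G.Adj d k, ⟨hK, Finset.filter_subset _ _, ?_, hmax,
        fun Q hQ => ?_⟩, D, ⟨hKD, hD, fun u hu => (Finset.mem_filter.mp hu).2⟩, hT⟩
      · by_contra! hcon
        have := h.replace hK hKD hU2 hES (Q := ∅) (fun _ _ a ha => absurd ha (Finset.notMem_empty a))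
          (fun q hq => absurd hq (Finset.notMem_empty q)) (fun h2 => absurd (le_antisymm hU2 h2)
          hcon.2)
        rw [hsd, Finset.union_empty] at this
        exact hKK this
      · have := h.replace hK hKD hU2 hES hQ.conn (fun q hq hqX => (Finset.mem_union.mp hqX).resolve_left
          fun hqK => Finset.disjoint_left.mp hQ.disj hqK hq) (fun _ => hQ.att)
        rwa [hsd] at this
  obtain ⟨Q', hQ', hmin⟩ := Finset.exists_min_image
    (Finset.univ.filter fun Q => G.IsLink K U Q ∧ T.HasCopy G (K ∪ Q)ᶜ) Finset.card
    ⟨Q, Finset.mem_filter.mpr ⟨Finset.mem_univ _, hQ, hQT⟩⟩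
  simp only [Finset.mem_filter, Finset.mem_univ, true_and, and_imp] at hQ' hmin
  exact ⟨U, Q', hU, hQ'.1, hQ'.2, hmin⟩

lemma IsLinkable.card_filter_le {K U Q X D : Finset V} (hU : T.IsLinkable G K U)
    (hQ : G.IsLink K U Q) (hQX : K ∪ Q ⊆ X) (hT : T.HasCopy G Xᶜ) (hDX : D ⊆ X) (hD : G.ConnOn D)
    (hKD : Disjoint K D) : (K.filter fun k => ∃ d ∈ D, G.Adj d k).card ≤ 2 :=
  card_filter_attached_le_two hU.max ((hU.insep Q hQ).mono hQX) hT hDX hD hKD.symm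

lemma IsLinkable.card_le_two {K U : Finset V} (hU : T.IsLinkable G K U) : U.card ≤ 2 := by
  rcases hU.card with h | h
  · simp [h]
  · exact h.le

lemma IsMinLink.card_eq_two {K U Q : Finset V} (hU : T.IsLinkable G K U)
    (hQ : T.IsMinLink G K U Q) (hne : Q.Nonempty) : U.card = 2 := by
  refine hU.card.resolve_left fun hU0 => ?_
  have h1 := hQ.min ∅ ⟨Finset.disjoint_empty_right _,
    fun _ _ a ha => absurd ha (Finset.notMem_empty a),
    fun u hu => absurd (hU0 ▸ hu) (Finset.notMem_empty u)⟩
    (hQ.copy.mono (Finset.compl_subset_compl.mpr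
      (Finset.union_subset_union_right (Finset.empty_subset _))))
  have := Finset.card_pos.mpr hne
  rw [Finset.card_empty] at h1
  omega

/-- A connected set containing a link is attached to `K` at `U` only. -/
lemma IsMinLink.mem_of_adj {K U Q D X : Finset V} (hU : T.IsLinkable G K U)
    (hQ : T.IsMinLink G K U Q) (hQX : K ∪ Q ⊆ X) (hT : T.HasCopy G Xᶜ) (hDX : D ⊆ X)
    (hD : G.ConnOn D) (hKD : Disjoint K D) (hQD : Q ⊆ D) (hne : Q.Nonempty) {d k : V} (hd : d ∈ D)
    (hk : k ∈ K) (hdk : G.Adj d k) : k ∈ U := by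
  have h1 := hU.card_filter_le hQ.link hQX hT hDX hD hKD
  have h2 : U ⊆ K.filter fun k => ∃ d ∈ D, G.Adj d k := fun u hu => by
    obtain ⟨q, hq, hqu⟩ := hQ.link.att u hu
    exact Finset.mem_filter.mpr ⟨hU.sub hu, q, hQD hq, hqu⟩
  rw [Finset.eq_of_subset_of_card_le h2 (by rw [hQ.card_eq_two hU hne]; exact h1)]
  exact Finset.mem_filter.mpr ⟨hk, d, hd, hdk⟩

lemma IsMinLink.link_mem_of_adj {K U Q : Finset V} (hU : T.IsLinkable G K U)
    (hQ : T.IsMinLink G K U Q) {q k : V} (hq : q ∈ Q) (hk : k ∈ K) (hqk : G.Adj q k) : k ∈ U :=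
  hQ.mem_of_adj hU (Finset.Subset.refl _) hQ.copy Finset.subset_union_right hQ.link.conn
    hQ.link.disj (Finset.Subset.refl _) ⟨q, hq⟩ hq hk hqk

/-- Shortening a connected set that contains a link. -/
lemma IsLinkable.exists_link {K U D : Finset V} (hU : T.IsLinkable G K U) (hD : G.ConnOn D)
    (hKD : Disjoint K D) (hatt : ∀ u ∈ U, ∃ d ∈ D, G.Adj d u) {z : V} (hz : z ∈ D)
    (hzU : ∀ k ∈ K, G.Adj z k → k ∈ U) :
    ∃ P ⊆ D, z ∈ P ∧ G.IsLink K U P ∧ ((K ∪ D).filter (G.Adj z)).card + P.card ≤ D.card + 2 := by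
  obtain ⟨P, hPD, hzP, hP, hPU, hc⟩ := hD.exists_fan_card hz G.Adj U hatt
  refine ⟨P, hPD, hzP, ⟨Finset.disjoint_of_subset_right hPD hKD, hP, hPU⟩, ?_⟩
  have h1 : (K ∪ D).filter (G.Adj z) ⊆ D.filter (G.Adj z) ∪ U.filter (G.Adj z) := by
    intro y hy
    obtain ⟨hyKD, hzy⟩ := Finset.mem_filter.mp hy
    simp only [Finset.mem_union, Finset.mem_filter] at hyKD ⊢
    exact hyKD.elim (fun h => Or.inr ⟨hzU y h hzy, hzy⟩) fun h => Or.inl ⟨h, hzy⟩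
  have h2 := (Finset.card_le_card h1).trans (Finset.card_union_le _ _)
  have h3 := hU.card_le_two
  omega

lemma IsMinLink.eq_empty_of_card_eq [Fintype W] {K U Q : Finset V} (hU : T.IsLinkable G K U)
    (hQ : T.IsMinLink G K U Q)
    (hdeg : ∀ v, Fintype.card W + 3 ≤ (Finset.univ.filter (G.Adj v)).card)
    (hc : (K ∪ Q)ᶜ.card = Fintype.card W) : Q = ∅ := by
  by_contra hne
  obtain ⟨z, hz⟩ := Finset.nonempty_iff_ne_empty.mpr hne
  obtain ⟨P, hPQ, hzP, hP, hPc⟩ := hU.exists_link hQ.link.conn hQ.link.disj hQ.link.att hz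
    fun k hk => hQ.link_mem_of_adj hU hz hk
  have h1 := hQ.min P hP (hQ.copy.mono
    (Finset.compl_subset_compl.mpr (Finset.union_subset_union_right hPQ)))
  have h2 := G.card_filter_adj_add_compl (K ∪ Q) z
  have h3 := hdeg z
  have h4 := Finset.card_filter_le (K ∪ Q)ᶜ (G.Adj z)
  omega

lemma IsMinLink.card_le_of_hasCopy_erase {K U Q : Finset V} (hU : T.IsLinkable G K U)
    (hQ : T.IsMinLink G K U Q) {z : V} (hz : z ∈ (K ∪ Q)ᶜ) (hT : T.HasCopy G ((K ∪ Q)ᶜ.erase z)) :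
    (K.filter (G.LinkAdj U Q z)).card ≤ 2 ∧ ((K ∪ Q).filter (G.Adj z)).card ≤ 3 := by
  rw [Finset.mem_compl, Finset.mem_union, not_or] at hz
  rw [← Finset.compl_insert, ← Finset.union_insert] at hT
  have hKz : Disjoint K {z} := by simpa using hz.1
  have hKzQ : Disjoint K (insert z Q) := by
    rw [Finset.insert_eq]; exact Finset.disjoint_union_right.mpr ⟨hKz, hQ.link.disj⟩
  have hX : K ∪ Q ⊆ K ∪ insert z Q := Finset.union_subset_union_right (Finset.subset_insert _ _)
  by_cases hzQ : ∃ q ∈ Q, G.Adj q z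
  · obtain ⟨q, hq, hqz⟩ := hzQ
    have hD := hQ.link.conn.insert_of_adj hq hqz
    have hzU : ∀ k ∈ K, G.Adj z k → k ∈ U := fun k hk hzk =>
      hQ.mem_of_adj hU hX hT Finset.subset_union_right hD hKzQ (Finset.subset_insert _ _) ⟨q, hq⟩
        (Finset.mem_insert_self z Q) hk hzk
    refine ⟨(Finset.card_le_card fun k hk => ?_).trans hU.card_le_two, ?_⟩
    · obtain ⟨hkK, hk⟩ := Finset.mem_filter.mp hk
      exact hk.elim (hzU k hkK) And.left
    · obtain ⟨P, hPQ, hzP, hP, hPc⟩ := hU.exists_link hD hKzQ (fun u hu => by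
        obtain ⟨q, hq, hqu⟩ := hQ.link.att u hu
        exact ⟨q, Finset.mem_insert_of_mem hq, hqu⟩) (Finset.mem_insert_self z Q) hzU
      have h1 := hQ.min P hP (hT.mono
        (Finset.compl_subset_compl.mpr (Finset.union_subset_union_right hPQ)))
      have h2 := Finset.card_le_card (Finset.filter_subset_filter (G.Adj z) hX)
      rw [Finset.card_insert_of_notMem hz.2] at hPc
      omega
  · push Not at hzQ
    have h1 := hU.card_filter_le hQ.link hX hT (D := {z}) (by simp)
      (SimpleGraph.connOn_singleton z) hKz
    constructor
    · refine (Finset.card_le_card fun k hk => ?_).trans h1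
      obtain ⟨hkK, hk⟩ := Finset.mem_filter.mp hk
      refine Finset.mem_filter.mpr ⟨hkK, z, by simp, hk.resolve_right ?_⟩
      rintro ⟨_, q, hq, hzq⟩
      exact hzQ q hq hzq.symm
    · refine (Finset.card_le_card fun k hk => ?_).trans (h1.trans (by norm_num))
      obtain ⟨hkK, hk⟩ := Finset.mem_filter.mp hk
      refine Finset.mem_filter.mpr ⟨(Finset.mem_union.mp hkK).resolve_right fun h => ?_, z, by simp, hk⟩
      exact hzQ k h hk.symm

lemma IsMinLink.card_le_of_lt [Fintype W] {K U Q : Finset V} (hU : T.IsLinkable G K U)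
    (hQ : T.IsMinLink G K U Q)
    (hdeg : ∀ v, Fintype.card W + 3 ≤ (Finset.univ.filter (G.Adj v)).card)
    (hc : Fintype.card W < (K ∪ Q)ᶜ.card) : ∀ z ∈ (K ∪ Q)ᶜ,
    (K.filter (G.LinkAdj U Q z)).card ≤ 2 ∧ ((K ∪ Q).filter (G.Adj z)).card ≤ 3 := by
  by_contra! hcon
  obtain ⟨z, hz, hz'⟩ := hcon
  obtain ⟨a, ha, hTa⟩ := exists_hasCopy_erase (A := (K ∪ Q)ᶜ.filter fun z =>
    ¬ ((K.filter (G.LinkAdj U Q z)).card ≤ 2 ∧ ((K ∪ Q).filter (G.Adj z)).card ≤ 3))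
    ⟨z, by
      rw [Finset.mem_filter]
      exact ⟨hz, fun h => absurd h.2 (not_le.mpr (hz' h.1))⟩⟩ hQ.copy hc (by
      intro x hx hxA
      have h1 : (K.filter (G.LinkAdj U Q x)).card ≤ 2 ∧ ((K ∪ Q).filter (G.Adj x)).card ≤ 3 := by
        by_contra h
        exact hxA (Finset.mem_filter.mpr ⟨hx, h⟩)
      have h2 := G.card_filter_adj_add_compl (K ∪ Q) x
      have h3 := hdeg x
      omega)
  obtain ⟨haZ, ha⟩ := Finset.mem_filter.mp ha
  exact ha (hQ.card_le_of_hasCopy_erase hU haZ hTa)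

end

end ParentTree

namespace ParentTree

section

open scoped Classical

variable {W V : Type*} [Fintype V] {T : ParentTree W} {G : SimpleGraph V}

variable (G) in
/-- A connected set avoiding `K ∪ Q` that is attached to at least three vertices of `K`, directly or
through `Q`. -/
structure IsNonlocal (K U Q R : Finset V) : Prop where
  conn : G.ConnOn R
  sub : R ⊆ (K ∪ Q)ᶜ
  three_le : 3 ≤ (K.filter fun k => ∃ r ∈ R, G.LinkAdj U Q r k).card

lemma IsMinLink.exists_isNonlocal {K U Q : Finset V} (hU : T.IsLinkable G K U)
    (hQ : T.IsMinLink G K U Q) (hG : G.Insep Finset.univ Finset.univ) {z : V}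
    (hz : z ∈ (K ∪ Q)ᶜ) : ∃ R, IsNonlocal G K U Q R := by
  have hK := hU.four_le
  have hU2 := hU.card_le_two
  obtain ⟨x, hx, k, hk, hkU, hxk⟩ : ∃ x ∈ (K ∪ Q)ᶜ, ∃ k ∈ K, k ∉ U ∧ G.Adj x k := by
    by_contra! hcon
    obtain ⟨k, hk, hkU⟩ := Finset.exists_mem_notMem_of_card_lt_card
      (show U.card < K.card by omega)
    refine hG.2 U (K : Set V)ᶜ hU2 (fun a _ _ b _ hbU hab haK hbK => hbU ?_) z (Finset.mem_univ _)
      (fun h => ?_) (fun h => ?_) k (Finset.mem_univ _) hkU hk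
    · by_cases haQ : a ∈ Q
      · exact hQ.link_mem_of_adj hU haQ hbK hab
      · by_contra hbU'
        exact hcon a (by simp only [Finset.mem_compl, Finset.mem_union, not_or]
                         exact ⟨haK, haQ⟩) b hbK hbU' hab
    · exact Finset.mem_compl.mp hz (Finset.mem_union_left _ (hU.sub h))
    · exact Finset.mem_compl.mp hz (Finset.mem_union_left _ h)
  obtain ⟨L, hL, hxL, hLc, hLm⟩ := SimpleGraph.exists_component (G := G) hx
  refine ⟨L, hLc, hL, ?_⟩
  by_contra! hcon
  by_cases hLQ : ∃ l ∈ L, ∃ q ∈ Q, G.Adj l q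
  · obtain ⟨l, hl, q, hq, hlq⟩ := hLQ
    have h1 : insert k U ⊆ K.filter fun k => ∃ r ∈ L, G.LinkAdj U Q r k := by
      intro u hu
      rcases Finset.mem_insert.mp hu with rfl | hu
      · exact Finset.mem_filter.mpr ⟨hk, x, hxL, Or.inl hxk⟩
      · exact Finset.mem_filter.mpr ⟨hU.sub hu, l, hl, Or.inr ⟨hu, q, hq, hlq⟩⟩
    have h2 := Finset.card_le_card h1
    rw [Finset.card_insert_of_notMem hkU, hQ.card_eq_two hU ⟨q, hq⟩] at h2
    omega
  · push Not at hLQ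
    obtain ⟨j, hj, hjS⟩ := Finset.exists_mem_notMem_of_card_lt_card (show
      (K.filter fun k => ∃ r ∈ L, G.LinkAdj U Q r k).card < K.card by omega)
    have hLK : ∀ l ∈ L, l ∉ K := fun l hl h =>
      Finset.mem_compl.mp (hL hl) (Finset.mem_union_left _ h)
    refine hLK j (hG.2 (K.filter fun k => ∃ r ∈ L, G.LinkAdj U Q r k) (L : Set V) (by omega)
      (fun a _ _ b _ hbS hab haL => ?_) x (Finset.mem_univ _)
      (fun h => hLK x hxL (Finset.mem_filter.mp h).1) hxL j (Finset.mem_univ _) hjS) hj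
    refine hLm a haL b ?_ hab
    rw [Finset.mem_compl, Finset.mem_union, not_or]
    exact ⟨fun h => hbS (Finset.mem_filter.mpr ⟨h, a, haL, Or.inl hab⟩), fun h => hLQ a haL b h hab⟩

/-- Shortening a nonlocal set, keeping a given vertex `z`. -/
lemma exists_isNonlocal_subset {K U Q R : Finset V} (hR : IsNonlocal G K U Q R) {z : V}
    (hz : z ∈ R) (hz2 : (K.filter (G.LinkAdj U Q z)).card ≤ 2) :
    ∃ P ⊆ R, IsNonlocal G K U Q P ∧
      (R.filter (G.Adj z)).card + (K.filter (G.LinkAdj U Q z)).card + P.card ≤ R.card + 3 := by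
  have hsub : K.filter (G.LinkAdj U Q z) ⊆ K.filter fun k => ∃ r ∈ R, G.LinkAdj U Q r k :=
    fun k hk => Finset.mem_filter.mpr ⟨(Finset.mem_filter.mp hk).1, z, hz, (Finset.mem_filter.mp hk).2⟩
  obtain ⟨S, hzS, hSR, hS⟩ := Finset.exists_subsuperset_card_eq hsub (n := 3) (by omega) hR.three_le
  obtain ⟨P, hPR, hzP, hP, hPS, hc⟩ := hR.conn.exists_fan_card hz (G.LinkAdj U Q) S
    fun s hs => (Finset.mem_filter.mp (hSR hs)).2
  refine ⟨P, hPR, ⟨hP, hPR.trans hR.sub, hS ▸ Finset.card_le_card fun s hs =>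
    Finset.mem_filter.mpr ⟨(Finset.mem_filter.mp (hSR hs)).1, hPS s hs⟩⟩, ?_⟩
  have h1 : K.filter (G.LinkAdj U Q z) ⊆ S.filter (G.LinkAdj U Q z) := fun k hk =>
    Finset.mem_filter.mpr ⟨hzS hk, (Finset.mem_filter.mp hk).2⟩
  have h2 := Finset.card_le_card h1
  omega

/-- If `z` is adjacent to `Q`, then every vertex linked to `z` lies in `U`. -/
lemma IsMinLink.linkAdj_mem {K U Q : Finset V} (hU : T.IsLinkable G K U)
    (hQ : T.IsMinLink G K U Q) {z q : V} (hq : q ∈ Q) (hzq : G.Adj z q)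
    (hz2 : (K.filter (G.LinkAdj U Q z)).card ≤ 2) : K.filter (G.LinkAdj U Q z) = U := by
  refine (Finset.eq_of_subset_of_card_le (fun u hu => ?_) ?_).symm
  · exact Finset.mem_filter.mpr ⟨hU.sub hu, Or.inr ⟨hu, q, hq, hzq⟩⟩
  · rw [hQ.card_eq_two hU ⟨q, hq⟩]
    exact hz2

/-- Rerouting the link through `z` leaves a smaller nonlocal set. -/
lemma IsMinLink.exists_smaller_isNonlocal {K U Q R : Finset V} (hU : T.IsLinkable G K U)
    (hQ : T.IsMinLink G K U Q) (hR : IsNonlocal G K U Q R) {z : V} (hz : z ∈ (K ∪ Q)ᶜ) (hzR : z ∉ R)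
    (hT : T.HasCopy G ((K ∪ Q)ᶜ.erase z)) {q : V} (hq : q ∈ Q) (hzq : G.Adj z q)
    (hz2 : (K.filter (G.LinkAdj U Q z)).card ≤ 2) (hz3 : 3 ≤ ((K ∪ Q).filter (G.Adj z)).card)
    (hR2 : 2 ≤ (R.filter (G.Adj z)).card) :
    ∃ Q' R', T.IsMinLink G K U Q' ∧ IsNonlocal G K U Q' R' ∧ R'.card < R.card := by
  have hzU := hQ.linkAdj_mem hU hq hzq hz2
  have hU2 := hQ.card_eq_two hU ⟨q, hq⟩
  have hzU' : ∀ k ∈ K, G.Adj z k → k ∈ U := fun k hk hzk =>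
    hzU ▸ Finset.mem_filter.mpr ⟨hk, Or.inl hzk⟩
  rw [Finset.mem_compl, Finset.mem_union, not_or] at hz
  obtain ⟨Q', hQ'sub, hzQ', hQ', hQ'c⟩ := hU.exists_link
    (hQ.link.conn.insert_of_adj hq hzq.symm)
    (Finset.disjoint_left.mpr fun k hk hk' => by
      rcases Finset.mem_insert.mp hk' with rfl | hk'
      · exact hz.1 hk
      · exact Finset.disjoint_left.mp hQ.link.disj hk hk')
    (fun u hu => by
      obtain ⟨q, hq, hqu⟩ := hQ.link.att u hu
      exact ⟨q, Finset.mem_insert_of_mem hq, hqu⟩) (Finset.mem_insert_self z Q) hzU'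
  have hX : K ∪ Q ⊆ K ∪ insert z Q := Finset.union_subset_union_right (Finset.subset_insert _ _)
  have hle : Q'.card ≤ Q.card := by
    have h1 := Finset.card_le_card (Finset.filter_subset_filter (G.Adj z) hX)
    rw [Finset.card_insert_of_notMem hz.2] at hQ'c
    omega
  rw [← Finset.compl_insert, ← Finset.union_insert] at hT
  have hQ'm : T.IsMinLink G K U Q' := ⟨hQ', hT.mono (Finset.compl_subset_compl.mpr
    (Finset.union_subset_union_right hQ'sub)), fun Q₁ h1 h2 => hle.trans (hQ.min Q₁ h1 h2)⟩
  obtain ⟨w, hw, hwU⟩ := Finset.exists_mem_notMem_of_card_lt_card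
    (show U.card < (K.filter fun k => ∃ r ∈ R, G.LinkAdj U Q r k).card from
      hU2 ▸ hR.three_le)
  obtain ⟨hwK, r, hr, hrw⟩ := Finset.mem_filter.mp hw
  have hrw' : G.Adj r w := hrw.resolve_right fun h => hwU h.1
  obtain ⟨y, hy⟩ := Finset.card_pos.mp (show 0 < (R.filter (G.Adj z)).card by omega)
  obtain ⟨hyR, hzy⟩ := Finset.mem_filter.mp hy
  obtain ⟨P, hPsub, hzP, hP, hPw, hPc⟩ := (hR.conn.insert_of_adj hyR hzy.symm).exists_fan
    (Finset.mem_insert_self z R) G.Adj {w} (by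
      simp only [Finset.mem_singleton, forall_eq]
      exact ⟨r, Finset.mem_insert_of_mem hr, hrw'⟩)
  rw [Finset.card_singleton] at hPc
  have hP1 : (P.filter (G.Adj z)).card ≤ 1 := by omega
  obtain ⟨p, hp, hpw⟩ := hPw w (by simp)
  have hpz : p ≠ z := fun h => hwU (hzU' w hwK (h ▸ hpw))
  obtain ⟨z', hz', p', hp', hp'z, hzp'⟩ := hP.exists_adj (L := {z}) (by simpa using hzP) (by simp)
    (fun h => hpz (by rw [← h] at hp; exact Finset.mem_singleton.mp hp))
  rw [Finset.mem_singleton] at hz' hp'z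
  subst hz'
  have hPR : P.erase z' ⊆ R := fun x hx =>
    (Finset.mem_insert.mp (hPsub (Finset.mem_erase.mp hx).2)).resolve_left (Finset.mem_erase.mp hx).1
  refine ⟨Q', P.erase z', hQ'm, ⟨hP.erase_of_card_le_one hP1, fun x hx => ?_, ?_⟩, ?_⟩
  · have h1 := hR.sub (hPR hx)
    rw [Finset.mem_compl, Finset.mem_union, not_or] at h1 ⊢
    refine ⟨h1.1, fun h => ?_⟩
    rcases Finset.mem_insert.mp (hQ'sub h) with rfl | h
    · exact (Finset.mem_erase.mp hx).1 rfl
    · exact h1.2 h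
  · have h1 : insert w U ⊆ K.filter fun k => ∃ r ∈ P.erase z', G.LinkAdj U Q' r k := by
      intro u hu
      rcases Finset.mem_insert.mp hu with rfl | hu
      · exact Finset.mem_filter.mpr ⟨hwK, p, Finset.mem_erase.mpr ⟨hpz, hp⟩, Or.inl hpw⟩
      · exact Finset.mem_filter.mpr ⟨hU.sub hu, p', Finset.mem_erase.mpr ⟨hp'z, hp'⟩,
          Or.inr ⟨hu, z', hzQ', hzp'.symm⟩⟩
    have h2 := Finset.card_le_card h1
    rwa [Finset.card_insert_of_notMem hwU, hU2] at h2
  · refine Finset.card_lt_card (Finset.ssubset_iff_subset_ne.mpr ⟨hPR, fun h => ?_⟩)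
    have h1 : R.filter (G.Adj z') ⊆ P.filter (G.Adj z') :=
      Finset.filter_subset_filter _ (h ▸ Finset.erase_subset _ _)
    have h2 := Finset.card_le_card h1
    omega

lemma IsMinLink.card_compl_eq {K U Q Q' : Finset V} (hQ : T.IsMinLink G K U Q)
    (hQ' : T.IsMinLink G K U Q') : (K ∪ Q)ᶜ.card = (K ∪ Q')ᶜ.card := by
  rw [Finset.card_compl, Finset.card_compl, Finset.card_union_of_disjoint hQ.link.disj,
    Finset.card_union_of_disjoint hQ'.link.disj,
    (hQ.min Q' hQ'.link hQ'.copy).antisymm (hQ'.min Q hQ.link hQ.copy)]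

/-- A linkable set is the complement of a copy of `T`. -/
lemma exists_insep_self [Fintype W] {K U Q : Finset V} (hU : T.IsLinkable G K U)
    (hQ : T.IsMinLink G K U Q) (hG : G.Insep Finset.univ Finset.univ)
    (hdeg : ∀ v, Fintype.card W + 3 ≤ (Finset.univ.filter (G.Adj v)).card) :
    G.Insep K K ∧ T.HasCopy G Kᶜ ∧ Kᶜ.card = Fintype.card W := by
  have hQT := hQ.copy.card_le
  by_cases hc : (K ∪ Q)ᶜ.card = Fintype.card W
  · obtain rfl := hQ.eq_empty_of_card_eq hU hdeg hc
    rw [Finset.union_empty] at hc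
    have := hU.insep ∅ hQ.link
    rw [Finset.union_empty] at this
    exact ⟨this, by simpa using hQ.copy, hc⟩
  exfalso
  have hmpos : 0 < Fintype.card W := Fintype.card_pos_iff.mpr ⟨T.root⟩
  obtain ⟨z₀, hz₀⟩ := Finset.card_pos.mp (show 0 < (K ∪ Q)ᶜ.card by omega)
  obtain ⟨R₀, hR₀⟩ := hQ.exists_isNonlocal hU hG hz₀
  obtain ⟨⟨Q', R⟩, h, hmin⟩ := Finset.exists_min_image
    (Finset.univ.filter fun p : Finset V × Finset V =>
      T.IsMinLink G K U p.1 ∧ IsNonlocal G K U p.1 p.2)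
    (fun p => p.2.card) ⟨(Q, R₀), Finset.mem_filter.mpr ⟨Finset.mem_univ _, hQ, hR₀⟩⟩
  simp only [Finset.mem_filter, Finset.mem_univ, true_and, and_imp, Prod.forall] at h hmin
  have hc' : Fintype.card W < (K ∪ Q')ᶜ.card := by
    rw [← hQ.card_compl_eq h.1]
    omega
  clear hc hQT hz₀ z₀ hR₀ R₀ hQ Q
  obtain ⟨hQ, hR⟩ := h
  have hA := hQ.card_le_of_lt hU hdeg hc'
  have hsplit : ∀ z, Fintype.card W + 3 ≤ ((K ∪ Q').filter (G.Adj z)).card +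
      (R.filter (G.Adj z)).card + (((K ∪ Q')ᶜ \ R).filter (G.Adj z)).card := by
    intro z
    have h1 := G.card_filter_adj_add_compl (K ∪ Q') z
    have h2 := hdeg z
    have h3 : (K ∪ Q')ᶜ.filter (G.Adj z) ⊆
        R.filter (G.Adj z) ∪ ((K ∪ Q')ᶜ \ R).filter (G.Adj z) := by
      rw [← Finset.filter_union]
      refine Finset.filter_subset_filter _ fun x hx => ?_
      by_cases hxR : x ∈ R
      · exact Finset.mem_union_left _ hxR
      · exact Finset.mem_union_right _ (Finset.mem_sdiff.mpr ⟨hx, hxR⟩)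
    have h4 := (Finset.card_le_card h3).trans (Finset.card_union_le _ _)
    omega
  have herase : ∀ z ∈ (K ∪ Q')ᶜ, T.HasCopy G ((K ∪ Q')ᶜ.erase z) := by
    intro z hz
    refine hasCopy_of_degree (Finset.card_pos.mp ?_) fun x hx => ?_
    · rw [Finset.card_erase_of_mem hz]
      omega
    · have h1 := G.card_filter_adj_add_compl (K ∪ Q') x
      have h2 := hdeg x
      have h3 := (hA x (Finset.mem_erase.mp hx).2).2
      have h4 : ((K ∪ Q')ᶜ.filter (G.Adj x)).erase z ⊆ ((K ∪ Q')ᶜ.erase z).filter (G.Adj x) := by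
        intro y hy
        simp only [Finset.mem_erase, Finset.mem_filter] at hy ⊢
        exact ⟨⟨hy.1, hy.2.1⟩, hy.2.2⟩
      have h5 := Finset.card_le_card h4
      have h6 := Finset.pred_card_le_card_erase (s := (K ∪ Q')ᶜ.filter (G.Adj x)) (a := z)
      omega
  have hnotadj : ∀ z, (¬ ∃ q ∈ Q', G.Adj z q) →
      ((K ∪ Q').filter (G.Adj z)).card ≤ (K.filter (G.LinkAdj U Q' z)).card := by
    intro z hzQ
    refine Finset.card_le_card fun y hy => ?_
    obtain ⟨hyK, hzy⟩ := Finset.mem_filter.mp hy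
    exact Finset.mem_filter.mpr ⟨(Finset.mem_union.mp hyK).resolve_right
      fun h => hzQ ⟨y, h, hzy⟩, Or.inl hzy⟩
  have hshort : ∀ R', IsNonlocal G K U Q' R' → ∀ z ∈ R', z ∈ (K ∪ Q')ᶜ →
      (R'.filter (G.Adj z)).card + (K.filter (G.LinkAdj U Q' z)).card + R.card ≤ R'.card + 3 := by
    intro R' hR' z hz hzZ
    obtain ⟨P, _, hP, hPc⟩ := exists_isNonlocal_subset hR' hz (hA z hzZ).1
    have := hmin Q' P hQ hP
    omega
  have hfour : ∀ z ∈ (K ∪ Q')ᶜ, z ∉ R →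
      ((K ∪ Q').filter (G.Adj z)).card + (R.filter (G.Adj z)).card ≤ 4 := by
    intro z hz hzR
    by_contra hcon
    have h1 := hA z hz
    obtain ⟨y, hy⟩ := Finset.card_pos.mp (show 0 < (R.filter (G.Adj z)).card by omega)
    obtain ⟨hyR, hzy⟩ := Finset.mem_filter.mp hy
    have hR' : IsNonlocal G K U Q' (insert z R) := ⟨hR.conn.insert_of_adj hyR hzy.symm,
      Finset.insert_subset hz hR.sub, hR.three_le.trans (Finset.card_le_card fun k hk => by
        obtain ⟨hkK, r, hr, hrk⟩ := Finset.mem_filter.mp hk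
        exact Finset.mem_filter.mpr ⟨hkK, r, Finset.mem_insert_of_mem hr, hrk⟩)⟩
    have h2 := hshort _ hR' z (Finset.mem_insert_self _ _) hz
    have h3 := Finset.card_le_card
      (Finset.filter_subset_filter (G.Adj z) (Finset.subset_insert z R))
    rw [Finset.card_insert_of_notMem hzR] at h2
    by_cases hzQ : ∃ q ∈ Q', G.Adj z q
    · obtain ⟨q, hq, hzq⟩ := hzQ
      have h4 := hQ.card_eq_two hU ⟨q, hq⟩
      rw [hQ.linkAdj_mem hU hq hzq h1.1] at h2
      obtain ⟨Q₁, R₁, h5, h6, h7⟩ := hQ.exists_smaller_isNonlocal hU hR hz hzR (herase z hz) hq hzq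
        h1.1 (by omega) (by omega)
      have := hmin Q₁ R₁ h5 h6
      omega
    · have := hnotadj z hzQ
      omega
  have hne : ((K ∪ Q')ᶜ \ R).Nonempty := by
    have hU2 := hU.card_le_two
    obtain ⟨w, hw, hwU⟩ := Finset.exists_mem_notMem_of_card_lt_card
      (show U.card < (K.filter fun k => ∃ r ∈ R, G.LinkAdj U Q' r k).card from
        Nat.lt_of_le_of_lt hU2 hR.three_le)
    obtain ⟨hwK, r, hr, hrw⟩ := Finset.mem_filter.mp hw
    have h1 := hA r (hR.sub hr)
    have h2 := hshort R hR r hr (hR.sub hr)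
    have h3 := hnotadj r fun ⟨q, hq, hrq⟩ => hwU
      (hQ.linkAdj_mem hU hq hrq h1.1 ▸ Finset.mem_filter.mpr ⟨hwK, hrw⟩)
    have h4 := hsplit r
    obtain ⟨x, hx⟩ := Finset.card_pos.mp
      (show 0 < (((K ∪ Q')ᶜ \ R).filter (G.Adj r)).card by omega)
    exact ⟨x, (Finset.mem_filter.mp hx).1⟩
  have hTR : T.HasCopy G (K ∪ Q' ∪ R)ᶜ := by
    have : (K ∪ Q' ∪ R)ᶜ = (K ∪ Q')ᶜ \ R := by
      ext x; simp [and_assoc]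
    rw [this]
    refine hasCopy_of_degree hne fun z hz => ?_
    obtain ⟨hzZ, hzR⟩ := Finset.mem_sdiff.mp hz
    have h1 := hfour z hzZ hzR
    have h2 := hsplit z
    omega
  have hKR : Disjoint K R := Finset.disjoint_left.mpr fun k hk hkR =>
    Finset.mem_compl.mp (hR.sub hkR) (Finset.mem_union_left _ hk)
  have hthree := hR.three_le
  by_cases hRQ : ∃ r ∈ R, ∃ q ∈ Q', G.Adj r q
  · obtain ⟨r, hr, q, hq, hrq⟩ := hRQ
    have h1 := hU.card_filter_le hQ.link Finset.subset_union_left hTR (D := R ∪ Q')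
      (Finset.union_subset Finset.subset_union_right
        (Finset.subset_union_right.trans Finset.subset_union_left))
      (hR.conn.union_of_adj hQ.link.conn hr hq hrq)
      (Finset.disjoint_union_right.mpr ⟨hKR, hQ.link.disj⟩)
    have h2 : (K.filter fun k => ∃ r ∈ R, G.LinkAdj U Q' r k) ⊆
        K.filter fun k => ∃ d ∈ R ∪ Q', G.Adj d k := by
      intro k hk
      obtain ⟨hkK, x, hx, hxk | ⟨hkU, _⟩⟩ := Finset.mem_filter.mp hk
      · exact Finset.mem_filter.mpr ⟨hkK, x, Finset.mem_union_left _ hx, hxk⟩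
      · obtain ⟨p, hp, hpk⟩ := hQ.link.att k hkU
        exact Finset.mem_filter.mpr ⟨hkK, p, Finset.mem_union_right _ hp, hpk⟩
    have h3 := Finset.card_le_card h2
    omega
  · have h1 := hU.card_filter_le hQ.link Finset.subset_union_left hTR (D := R)
      Finset.subset_union_right hR.conn hKR
    have h2 : (K.filter fun k => ∃ r ∈ R, G.LinkAdj U Q' r k) ⊆
        K.filter fun k => ∃ d ∈ R, G.Adj d k := by
      intro k hk
      obtain ⟨hkK, x, hx, hxk | ⟨_, q, hq, hxq⟩⟩ := Finset.mem_filter.mp hk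
      · exact Finset.mem_filter.mpr ⟨hkK, x, hx, hxk⟩
      · exact absurd ⟨x, hx, q, hq, hxq⟩ hRQ
    have h3 := Finset.card_le_card h2
    omega

end

end ParentTree

namespace SimpleGraph

section

open scoped Classical

variable {V : Type*} {G : SimpleGraph V}

lemma Reachable.mem_of_closed {a b : V} (h : G.Reachable a b) {C : Set V}
    (hC : ∀ x y, G.Adj x y → x ∈ C → y ∈ C) (ha : a ∈ C) : b ∈ C := by
  obtain ⟨p⟩ := h
  induction p with
  | nil => exact ha
  | cons h _ ih => exact ih (hC _ _ h ha)

lemma IsKConnected.insep_univ [Fintype V] (h : G.IsKConnected 3) :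
    G.Insep Finset.univ Finset.univ := by
  refine ⟨Finset.Subset.refl _, fun S C hS hC a _ haS haC b _ hbS => ?_⟩
  exact ((h.2 S (by omega)).preconnected ⟨a, by simpa using haS⟩
    ⟨b, by simpa using hbS⟩).mem_of_closed (C := Subtype.val ⁻¹' C)
    (fun x y hxy hx => hC x (Finset.mem_univ _) x.2 y (Finset.mem_univ _)
      y.2 hxy hx) haC

lemma Insep.isKConnected_induce {X : Finset V} (h : G.Insep X X) (hX : 4 ≤ X.card) :
    (G.induce (X : Set V)).IsKConnected 3 := by
  refine ⟨by simpa using Nat.lt_of_succ_le hX, fun S hS => ?_⟩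
  have hS' : (S.image Subtype.val).card ≤ 2 := Finset.card_image_le.trans (by omega)
  have hmem : ∀ x : (X : Set V), (x : V) ∈ S.image Subtype.val ↔ x ∈ S := by
    intro x
    simp
  rw [connected_iff]
  constructor
  · rintro ⟨⟨a, ha⟩, haS⟩ ⟨⟨b, hb⟩, hbS⟩
    obtain ⟨h1, h2, h3⟩ := h.2 (S.image Subtype.val)
      {v | ∃ (h : v ∈ (X : Set V)) (h' : (⟨v, h⟩ : (X : Set V)) ∈ ((S : Set (X : Set V))ᶜ)),
        ((G.induce (X : Set V)).induce ((S : Set (X : Set V))ᶜ)).Reachable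
          ⟨⟨a, ha⟩, haS⟩ ⟨⟨v, h⟩, h'⟩} hS'
      (by
        rintro x hx hxS y hy hyS hxy ⟨h1, h2, h3⟩
        have hyS' : (⟨y, hy⟩ : (X : Set V)) ∈ ((S : Set (X : Set V))ᶜ) := fun h =>
          hyS ((hmem ⟨y, hy⟩).mpr h)
        refine ⟨hy, hyS', h3.trans (Adj.reachable ?_)⟩
        exact hxy) a ha (fun h => haS ((hmem ⟨a, ha⟩).mp h)) ⟨ha, haS, Reachable.refl _⟩ b hb
      (fun h => hbS ((hmem ⟨b, hb⟩).mp h))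
    exact h3
  · obtain ⟨x, hx, hxS⟩ := Finset.exists_mem_notMem_of_card_lt_card
      (show (S.image Subtype.val).card < X.card by omega)
    exact ⟨⟨⟨x, hx⟩, fun h => hxS ((hmem ⟨x, hx⟩).mpr h)⟩⟩

/-- Rooting a finite tree. -/
lemma IsTree.exists_parentTree [Fintype V] (h : G.IsTree) :
    ∃ T : ParentTree V, ∀ a b, G.Adj a b →
      (a ≠ T.root ∧ T.parent a = b) ∨ (b ≠ T.root ∧ T.parent b = a) := by
  obtain ⟨ρ⟩ := h.connected.nonempty
  have hpar : ∀ w, ∃ u, w ≠ ρ → G.Adj w u ∧ G.dist u ρ < G.dist w ρ := by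
    intro w
    by_cases hw : w = ρ
    · exact ⟨w, fun h => absurd hw h⟩
    obtain ⟨p, hp⟩ := h.connected.exists_walk_length_eq_dist w ρ
    cases p with
    | nil => exact absurd rfl hw
    | cons hadj q =>
      refine ⟨_, fun _ => ⟨hadj, ?_⟩⟩
      have := dist_le q
      rw [Walk.length_cons] at hp
      omega
  choose par hpar using hpar
  refine ⟨⟨ρ, par, fun w => G.dist w ρ, fun w hw => (hpar w hw).2⟩, fun a b hab => ?_⟩
  have hinj : Set.InjOn (fun w => s(w, par w)) (Finset.univ.erase ρ : Finset V) := by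
    intro v hv w hw hvw
    simp only [Finset.coe_erase, Finset.coe_univ, Set.mem_sdiff, Set.mem_univ, true_and,
      Set.mem_singleton_iff] at hv hw
    rcases Sym2.eq_iff.mp hvw with h1 | h1
    · exact h1.1
    · have h2 := (hpar v hv).2
      have h3 := (hpar w hw).2
      rw [h1.2] at h2
      rw [← h1.1] at h3
      omega
  have hsub : (Finset.univ.erase ρ).image (fun w => s(w, par w)) ⊆ G.edgeFinset := by
    intro e he
    obtain ⟨w, hw, rfl⟩ := Finset.mem_image.mp he
    rw [mem_edgeFinset, mem_edgeSet]
    exact (hpar w (Finset.mem_erase.mp hw).1).1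
  have heq := Finset.eq_of_subset_of_card_le hsub (by
    have := h.card_edgeFinset
    rw [Finset.card_image_of_injOn hinj, Finset.card_erase_of_mem (Finset.mem_univ _),
      Finset.card_univ]
    omega)
  have he : s(a, b) ∈ (Finset.univ.erase ρ).image (fun w => s(w, par w)) := by
    rw [heq, mem_edgeFinset, mem_edgeSet]
    exact hab
  obtain ⟨w, hw, hwe⟩ := Finset.mem_image.mp he
  have hwρ := (Finset.mem_erase.mp hw).1
  rcases Sym2.eq_iff.mp hwe with h1 | h1
  · exact Or.inl ⟨h1.1 ▸ hwρ, h1.1 ▸ h1.2⟩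
  · exact Or.inr ⟨h1.1 ▸ hwρ, h1.1 ▸ h1.2⟩

end

end SimpleGraph

namespace ParentTree

section

open scoped Classical

variable {W V : Type*} [Fintype W] [Fintype V] {T : ParentTree W} {G : SimpleGraph V}

/-- Some inseparable set of at least four vertices is the complement of a copy of `T`. -/
theorem exists_insep_compl_copy [Nonempty V] (hG : G.Insep Finset.univ Finset.univ)
    (hdeg : ∀ v, Fintype.card W + 3 ≤ (Finset.univ.filter (G.Adj v)).card) :
    ∃ K, 4 ≤ K.card ∧ G.Insep K K ∧ T.HasCopy G Kᶜ ∧ Kᶜ.card = Fintype.card W := by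
  obtain ⟨Z, _, hZ, hZc⟩ := (hasCopy_of_degree (T := T) (G := G) Finset.univ_nonempty
    fun z _ => by have := hdeg z; omega).exists_card_eq
  have h3 : ∀ v, 3 ≤ (Zᶜ.filter (G.Adj v)).card := by
    intro v
    have h1 := G.card_filter_adj_add_compl Z v
    have h2 := hdeg v
    have h3 := Finset.card_filter_le Z (G.Adj v)
    omega
  obtain ⟨v⟩ := ‹Nonempty V›
  obtain ⟨x, hx⟩ := Finset.card_pos.mp (show 0 < (Zᶜ.filter (G.Adj v)).card from
    lt_of_lt_of_le (by norm_num) (h3 v))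
  obtain ⟨K₀, hK₀, hins⟩ := SimpleGraph.exists_insep_of_three_le_degree
    ⟨x, (Finset.mem_filter.mp hx).1⟩ fun x _ => h3 x
  obtain ⟨K, D, h1, h2, h3, h4, h5, _, h6⟩ := exists_insep_union_connOn hdeg hG
    ⟨K₀, Zᶜ, hK₀, hins, by rwa [compl_compl]⟩
  obtain ⟨U, Q, hU, hQ⟩ := exists_isLinkable h1 h2 h3 h4 h5 h6
  exact ⟨K, h1, exists_insep_self hU hQ hG hdeg⟩

end

end ParentTree

theorem theorem3p2 {W V : Type*} [Fintype W] [Fintype V]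
    (m : ℕ) (T₀ : SimpleGraph W) (hT₀ : T₀.IsTree) (hm : Fintype.card W = m)
    (G : SimpleGraph V) [DecidableRel G.Adj]
    (hG : G.IsKConnected 3) (hδ : m + 3 ≤ G.minDegree) :
    ∃ T : G.Subgraph, Nonempty (T₀ ≃g T.coe) ∧ (G.induce (T.vertsᶜ)).IsKConnected 3 := by
  classical
  obtain ⟨T, hT⟩ := hT₀.exists_parentTree
  have hV : Nonempty V := by
    rw [← not_isEmpty_iff]
    intro h
    have := hG.1
    simp at this
  obtain ⟨K, hK4, hK, ⟨φ, hφ⟩, hKc⟩ := T.exists_insep_compl_copy hG.insep_univ fun v => by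
    have := hδ.trans (G.minDegree_le_degree v)
    rw [← G.card_neighborFinset_eq_degree, G.neighborFinset_eq_filter, ← hm] at this
    exact this.trans (Finset.card_le_card fun x hx => by simpa using hx)
  let f : SimpleGraph.Copy T₀ G := ⟨⟨φ, fun {a b} hab => by
    rcases hT a b hab with ⟨h, rfl⟩ | ⟨h, rfl⟩
    · exact hφ.adj a h
    · exact (hφ.adj b h).symm⟩, hφ.inj⟩
  have hverts : f.toSubgraph.vertsᶜ = (K : Set V) := by
    have h1 : Finset.univ.image φ = Kᶜ := by
      refine Finset.eq_of_subset_of_card_le (fun x hx => ?_) ?_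
      · obtain ⟨w, _, rfl⟩ := Finset.mem_image.mp hx
        exact hφ.mem w
      · rw [Finset.card_image_of_injective _ hφ.inj, Finset.card_univ, hKc]
    have h2 : f.toSubgraph.verts = ((Finset.univ.image φ : Finset V) : Set V) := by
      ext x
      simp [f, SimpleGraph.Copy.toSubgraph]
    rw [h2, h1]
    simp
  refine ⟨f.toSubgraph, ⟨f.isoToSubgraph⟩, ?_⟩
  rw [hverts]
  exact hK.isKConnected_induce hK4
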